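/- Let $d\in\mathbb N$ and let $f:\mathbb R^d\to\mathbb R$ be convex and subdifferentially polynomially bounded with parameters $R_1\ge 0$, $R_2>0$ and an integer $m\ge 0$, where $R_1=0$ if and only if $m=0$. This means that $f$ is locally Lipschitz and $\sup_{\zeta\in\partial_C f(x)}\|\zeta\|\le R_1\|x\|^m+R_2$ for all $x\in\mathbb R^d$ (with $0^0=1$), where $\partial_C f$ is the Clarke subdifferential. Let $\Omega\subseteq\mathbb R^d$ be closed and convex, let $P_\Omega$ be the Euclidean projection onto $\Omega$, and let $x^*$ be a minimizer of $f$ over $\Omega$. Let $\sigma>0$ and let $f_\sigma(x)=\mathbb E_{u\sim\mathcal N(0,I)}[f(x+\sigma u)]$ be the Gaussian smoothing of $f$. Let $x^0\in\Omega$ and $\tau_k\in(0,1]$ $(k\ge 0)$ be deterministic, let $u^0,u^1,\dots$ be independent $\mathcal N(0,I)$ random vectors in $\mathbb R^d$, and for $k\ge 0$ define $$v^k=\frac{f(x^k+\sigma u^k)-f(x^k)}{\sigma}\,u^k,\qquad x^{k+1}=P_\Omega\!\left(x^k-\tau_k\,\frac{v^k}{\|x^k\|^m+1}\right).$$ Put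 $$\mathcal H_{(2)}=3\max\Big\{2^{2(m-1)}R_1^2(4+d)^2,\ R_2^2(4+d)^2+2^{2(m-1)}R_1^2\sigma^{2m}\,[2(m+2)+d]^{m+2}\Big\},$$ $$\mathcal M(x)=\big(2^{m-1}R_1\|x\|^m+R_2\big)\sqrt d+2^{m-1}R_1\sigma^m(m+1+d)^{\frac{m+1}{2}}.$$ Then all expectations below are finite, and the following hold. (i) For every $k\ge 0$ and every $z\in\arg\min_{u\in\Omega}f_\sigma(u)$, $$0\le \mathbb E\big[\|x^k-z\|^2\big]-\mathbb E\big[\|x^{k+1}-z\|^2\big]+\mathcal H_{(2)}\tau_k^2 .$$ (ii) For every integer $T>0$, $$\min_{0\le k\le T}\mathbb E\left[\frac{f(x^k)-f(x^*)}{\|x^k\|^m+1}\right]\le\frac{1}{2\sum_{k=0}^T\tau_k}\left[\|x^0-x^*\|^2+\mathcal H_{(2)}\sum_{k=0}^T\tau_k^2\right]+\mathcal M(x^*)\,\sigma .$$ -/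

import Mathlib

open MeasureTheory ProbabilityTheory Filter Topology

namespace SPBOpt

/-- The Clarke directional derivative `limsup_{x' → x, t ↓ 0} (f (x' + t v) - f x') / t`. -/
noncomputable def clarkeDeriv {d : ℕ} (f : EuclideanSpace ℝ (Fin d) → ℝ)
    (x v : EuclideanSpace ℝ (Fin d)) : ℝ :=
  limsup (fun p : EuclideanSpace ℝ (Fin d) × ℝ => (f (p.1 + p.2 • v) - f p.1) / p.2)
    (𝓝 x ×ˢ 𝓝[>] (0 : ℝ))

/-- The Clarke subdifferential of `f` at `x`. -/
def clarkeSubdiff {d : ℕ} (f : EuclideanSpace ℝ (Fin d) → ℝ)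
    (x : EuclideanSpace ℝ (Fin d)) : Set (EuclideanSpace ℝ (Fin d)) :=
  {s | ∀ v, inner ℝ s v ≤ clarkeDeriv f x v}

/-- `f` is subdifferentially polynomially bounded with parameters `R₁`, `R₂` and `m`:
it is locally Lipschitz and every Clarke subgradient at `x` has norm at most
`R₁ ‖x‖ ^ m + R₂`. -/
structure IsSPB {d : ℕ} (f : EuclideanSpace ℝ (Fin d) → ℝ) (R₁ R₂ : ℝ) (m : ℕ) : Prop where
  locallyLipschitz : LocallyLipschitz f
  R₁_nonneg : 0 ≤ R₁
  R₂_pos : 0 < R₂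
  R₁_eq_zero_iff : R₁ = 0 ↔ m = 0
  bound : ∀ x, ∀ s ∈ clarkeSubdiff f x, ‖s‖ ≤ R₁ * ‖x‖ ^ m + R₂

/-- The Gaussian smoothing `f_σ(x) = E_{u ∼ N(0, I)} [f (x + σ u)]`. -/
noncomputable def gaussianSmoothing {d : ℕ} (f : EuclideanSpace ℝ (Fin d) → ℝ) (σ : ℝ)
    (x : EuclideanSpace ℝ (Fin d)) : ℝ :=
  ∫ u, f (x + σ • u) ∂(stdGaussian (EuclideanSpace ℝ (Fin d)))

/-- `p` is a point of `S` nearest to `x`. -/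
def IsNearest {d : ℕ} (S : Set (EuclideanSpace ℝ (Fin d)))
    (x p : EuclideanSpace ℝ (Fin d)) : Prop :=
  p ∈ S ∧ ∀ y ∈ S, ‖x - p‖ ≤ ‖x - y‖

/-- The projection of `x` onto `S`; for nonempty closed convex `S` it is the unique nearest
point, see `isNearest_iff_eq_proj`. -/
noncomputable def proj {d : ℕ} (S : Set (EuclideanSpace ℝ (Fin d)))
    (x : EuclideanSpace ℝ (Fin d)) : EuclideanSpace ℝ (Fin d) :=
  Classical.epsilon (IsNearest S x)

theorem isNearest_proj {d : ℕ} {S : Set (EuclideanSpace ℝ (Fin d))} (hne : S.Nonempty)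
    (hcl : IsClosed S) (x : EuclideanSpace ℝ (Fin d)) : IsNearest S x (proj S x) := by
  obtain ⟨p, hp, h⟩ := hcl.exists_infDist_eq_dist hne x
  refine Classical.epsilon_spec (p := IsNearest S x) ⟨p, hp, fun y hy => ?_⟩
  rw [← dist_eq_norm, ← dist_eq_norm, ← h]
  exact Metric.infDist_le_dist_of_mem hy

theorem isNearest_iff_inner {d : ℕ} {S : Set (EuclideanSpace ℝ (Fin d))}
    (hcv : Convex ℝ S) (x p : EuclideanSpace ℝ (Fin d)) :
    IsNearest S x p ↔ p ∈ S ∧ ∀ w ∈ S, inner ℝ (x - p) (w - p) ≤ 0 := by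
  refine and_congr_right fun hp => ?_
  rw [← norm_eq_iInf_iff_real_inner_le_zero hcv hp]
  have : Nonempty S := ⟨⟨p, hp⟩⟩
  have hb : BddBelow (Set.range fun w : S => ‖x - w‖) :=
    ⟨0, by rintro _ ⟨w, rfl⟩; exact norm_nonneg _⟩
  constructor
  · intro h
    exact le_antisymm (le_ciInf fun w => h w w.2) (ciInf_le hb ⟨p, hp⟩)
  · intro h y hy
    rw [h]
    exact ciInf_le hb ⟨y, hy⟩

theorem isNearest_iff_eq_proj {d : ℕ} {S : Set (EuclideanSpace ℝ (Fin d))} (hne : S.Nonempty)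
    (hcl : IsClosed S) (hcv : Convex ℝ S) (x p : EuclideanSpace ℝ (Fin d)) :
    IsNearest S x p ↔ p = proj S x := by
  have hq := isNearest_proj hne hcl x
  refine ⟨fun hp => ?_, fun h => h ▸ hq⟩
  rw [isNearest_iff_inner hcv] at hp hq
  have h1 := hp.2 _ hq.1
  have h2 := hq.2 _ hp.1
  have h3 : inner ℝ (p - proj S x) (p - proj S x) ≤ (0 : ℝ) := by
    have e : inner ℝ (p - proj S x) (p - proj S x)
        = inner ℝ (x - p) (proj S x - p) + inner ℝ (x - proj S x) (p - proj S x) := by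
      simp only [inner_sub_left, inner_sub_right]
      ring
    linarith
  exact sub_eq_zero.mp (real_inner_self_nonpos.mp h3)

/-- The two-point estimator `σ⁻¹ (f (x + σ u) - f x) u`. -/
noncomputable def estimator {d : ℕ} (f : EuclideanSpace ℝ (Fin d) → ℝ) (σ : ℝ)
    (x u : EuclideanSpace ℝ (Fin d)) : EuclideanSpace ℝ (Fin d) :=
  ((1 / σ) * (f (x + σ • u) - f x)) • u

/-- The iterates of the projected zeroth-order method driven by the directions `u 0, u 1, …`:
`x⁰ = x0` and `x^{k+1} = P_Ω (x^k - τ_k v^k / (‖x^k‖ ^ m + 1))`, where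
`v^k = σ⁻¹ (f (x^k + σ u^k) - f x^k) u^k`. -/
noncomputable def iterate {d : ℕ} (f : EuclideanSpace ℝ (Fin d) → ℝ)
    (Ω : Set (EuclideanSpace ℝ (Fin d))) (m : ℕ) (σ : ℝ) (τ : ℕ → ℝ)
    (x0 : EuclideanSpace ℝ (Fin d)) (u : ℕ → EuclideanSpace ℝ (Fin d)) :
    ℕ → EuclideanSpace ℝ (Fin d)
  | 0 => x0
  | k + 1 =>
    proj Ω (iterate f Ω m σ τ x0 u k
      - (τ k / (‖iterate f Ω m σ τ x0 u k‖ ^ m + 1))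
          • estimator f σ (iterate f Ω m σ τ x0 u k) (u k))

/-- The smoothing error coefficient
`M(x) = (2^{m-1} R₁ ‖x‖^m + R₂) √d + 2^{m-1} R₁ σ^m (m+1+d)^{(m+1)/2}`. -/
noncomputable def Mconst (d m : ℕ) (R₁ R₂ σ : ℝ) (x : EuclideanSpace ℝ (Fin d)) : ℝ :=
  ((2 : ℝ) ^ ((m : ℤ) - 1) * R₁ * ‖x‖ ^ m + R₂) * √(d : ℝ)
    + (2 : ℝ) ^ ((m : ℤ) - 1) * R₁ * σ ^ m
      * ((m : ℝ) + 1 + (d : ℝ)) ^ (((m : ℝ) + 1) / 2)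

/-- The moment constant `H_(p)`: it is `1` for `p = 0`, and for `p ≥ 1` it equals
`3^{p-1} max {2^{(m-1)p} R₁^p (2p+d)^p,
  R₂^p (2p+d)^p + 2^{(m-1)p} R₁^p σ^{mp} ((m+2)p+d)^{(m+2)p/2}}`. -/
noncomputable def Hconst (d m : ℕ) (R₁ R₂ σ : ℝ) (p : ℕ) : ℝ :=
  if p = 0 then 1 else
    (3 : ℝ) ^ (p - 1) *
      max ((2 : ℝ) ^ (((m : ℤ) - 1) * p) * R₁ ^ p * (2 * (p : ℝ) + d) ^ p)
        (R₂ ^ p * (2 * (p : ℝ) + d) ^ p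
          + (2 : ℝ) ^ (((m : ℤ) - 1) * p) * R₁ ^ p * σ ^ (m * p)
            * (((m : ℝ) + 2) * p + d) ^ (((m : ℝ) + 2) * p / 2))

end SPBOpt

/-! The argument is the projected subgradient method applied to `f_σ`, with the estimator as a
random subgradient. Three facts carry it. The estimator is unbiased enough: by Cameron–Martin the
shift in `g (u + s • a)` moves onto the smooth Gaussian weight, so the smoothing of a merely
continuous `g` of exponential growth is differentiable along lines. Convexity then bounds `f_σ(x) -
f_σ(z)` by the mean of `⟨v, x - z⟩`. The estimator is small enough: a convex function with
polynomially bounded subgradients has increments of size `O(‖x‖^m + 1)` for fixed `u`, with powers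
of `‖u‖` as coefficients. Gaussian moment bounds give `E ‖v‖² ≤ H (‖x‖^m + 1)²`, which the
normalized step turns into `H τ²` uniformly in `x`. Smoothing costs little: `f ≤ f_σ` everywhere by
Jensen, and `f_σ(z) - f(z) ≤ M(z) σ`. Expanding the square after a nonexpansive projection yields a
one-step inequality for a fixed iterate. As the iterate is independent of the next direction, Fubini
integrates it along the iteration. Minimality of `z` for `f_σ` gives (i); comparison with `f` and
telescoping give (ii). -/

namespace ProbabilityTheory

/-! ### Gaussian density, Cameron–Martin shift and moments -/

section Density

variable {E : Type*} [NormedAddCommGroup E] [InnerProductSpace ℝ E]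

/-- The Lebesgue density of the standard Gaussian measure. -/
noncomputable def stdGaussianDensity (x : E) : ℝ :=
  ((2 * Real.pi) ^ ((Module.finrank ℝ E : ℝ) / 2))⁻¹ * Real.exp (-(1 / 2) * ‖x‖ ^ 2)

lemma stdGaussianDensity_nonneg (x : E) : 0 ≤ stdGaussianDensity x := by
  unfold stdGaussianDensity; positivity

@[fun_prop]
lemma continuous_stdGaussianDensity : Continuous (stdGaussianDensity : E → ℝ) := by
  unfold stdGaussianDensity; fun_prop

lemma stdGaussianDensity_sub (u a : E) :
    stdGaussianDensity (u - a)
      = stdGaussianDensity u * Real.exp (inner ℝ u a - ‖a‖ ^ 2 / 2) := by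
  rw [stdGaussianDensity, stdGaussianDensity, mul_assoc, ← Real.exp_add, norm_sub_sq_real]
  congr 2
  ring

lemma stdGaussianDensity_mul_exp (t : ℝ) (u : E) :
    stdGaussianDensity u * Real.exp (t * ‖u‖ ^ 2)
      = ((2 * Real.pi) ^ ((Module.finrank ℝ E : ℝ) / 2))⁻¹ * Real.exp (-(1 / 2 - t) * ‖u‖ ^ 2) := by
  rw [stdGaussianDensity, mul_assoc, ← Real.exp_add]
  congr 2
  ring

end Density

variable {E : Type*} [NormedAddCommGroup E] [InnerProductSpace ℝ E] [FiniteDimensional ℝ E]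
  [MeasurableSpace E] [BorelSpace E]

lemma integrable_exp_neg_mul_sq_norm {b : ℝ} (hb : 0 < b) :
    Integrable (fun x : E => Real.exp (-b * ‖x‖ ^ 2)) := by
  have h := (GaussianFourier.integrable_cexp_neg_mul_sq_norm_add (V := E) (b := (b : ℂ))
    (by simpa using hb) 0 0).re
  refine h.congr (ae_of_all _ fun x => ?_)
  have : (-(b : ℂ) * (‖x‖ : ℂ) ^ 2 + 0 * ((inner ℝ (0 : E) x : ℝ) : ℂ))
      = ((-b * ‖x‖ ^ 2 : ℝ) : ℂ) := by push_cast; ring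
  change (Complex.exp _).re = _
  rw [this, Complex.exp_ofReal_re]

lemma integrable_stdGaussianDensity : Integrable (stdGaussianDensity : E → ℝ) :=
  (integrable_exp_neg_mul_sq_norm (by norm_num)).const_mul _

/-- Two finite measures with the same characteristic function agree; that of the density is a
Gaussian Fourier integral. -/
theorem stdGaussian_eq_withDensity :
    stdGaussian E = volume.withDensity (fun x => ENNReal.ofReal (stdGaussianDensity x)) := by
  have : IsFiniteMeasure
      (volume.withDensity (fun x : E => ENNReal.ofReal (stdGaussianDensity x))) :=
    isFiniteMeasure_withDensity_ofReal integrable_stdGaussianDensity.2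
  refine Measure.ext_of_charFun (funext fun t => ?_)
  rw [charFun_stdGaussian, charFun_apply, integral_withDensity_eq_integral_toReal_smul
    (by fun_prop) (by simp)]
  have hπ : (0 : ℝ) < (2 * Real.pi) ^ ((Module.finrank ℝ E : ℝ) / 2) := by positivity
  have key : ∀ x : E, (ENNReal.ofReal (stdGaussianDensity x)).toReal •
      Complex.exp (((inner ℝ x t : ℝ) : ℂ) * Complex.I)
      = ((((2 * Real.pi) ^ ((Module.finrank ℝ E : ℝ) / 2))⁻¹ : ℝ) : ℂ) *
        Complex.exp (-(1 / 2 : ℂ) * ‖x‖ ^ 2 + Complex.I * ((inner ℝ t x : ℝ) : ℂ)) := by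
    intro x
    rw [ENNReal.toReal_ofReal (stdGaussianDensity_nonneg x), Complex.real_smul,
      stdGaussianDensity, Complex.exp_add, real_inner_comm, mul_comm _ Complex.I]
    push_cast
    ring
  simp_rw [key]
  rw [integral_const_mul, GaussianFourier.integral_cexp_neg_mul_sq_norm_add (by norm_num)]
  have h1 : ((Real.pi : ℂ) / (1 / 2)) ^ ((Module.finrank ℝ E : ℂ) / 2)
      = (((2 * Real.pi) ^ ((Module.finrank ℝ E : ℝ) / 2) : ℝ) : ℂ) := by
    rw [Complex.ofReal_cpow (by positivity)]
    push_cast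
    congr 1
    ring
  rw [h1, ← mul_assoc, ← Complex.ofReal_mul, inv_mul_cancel₀ hπ.ne', Complex.ofReal_one, one_mul,
    Complex.I_sq]
  congr 1
  ring

lemma integral_stdGaussian_eq {F : Type*} [NormedAddCommGroup F] [NormedSpace ℝ F] (g : E → F) :
    ∫ u, g u ∂stdGaussian E = ∫ u, stdGaussianDensity u • g u := by
  rw [stdGaussian_eq_withDensity, integral_withDensity_eq_integral_toReal_smul
    (by fun_prop) (by simp)]
  simp_rw [ENNReal.toReal_ofReal (stdGaussianDensity_nonneg _)]

lemma integrable_stdGaussian_iff {F : Type*} [NormedAddCommGroup F] [NormedSpace ℝ F]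
    (g : E → F) :
    Integrable g (stdGaussian E) ↔ Integrable (fun u => stdGaussianDensity u • g u) := by
  rw [stdGaussian_eq_withDensity, integrable_withDensity_iff_integrable_smul'
    (by fun_prop) (by simp)]
  simp_rw [ENNReal.toReal_ofReal (stdGaussianDensity_nonneg _)]

/-- The Cameron–Martin formula for the standard Gaussian measure. -/
theorem integral_stdGaussian_comp_add {F : Type*} [NormedAddCommGroup F] [NormedSpace ℝ F]
    (g : E → F) (a : E) :
    ∫ u, g (u + a) ∂stdGaussian E
      = ∫ u, Real.exp (inner ℝ u a - ‖a‖ ^ 2 / 2) • g u ∂stdGaussian E := by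
  rw [integral_stdGaussian_eq, integral_stdGaussian_eq,
    ← integral_sub_right_eq_self _ a]
  simp_rw [sub_add_cancel, stdGaussianDensity_sub, mul_smul]

lemma integrable_exp_mul_sq_norm_stdGaussian {t : ℝ} (ht : t < 1 / 2) :
    Integrable (fun u : E => Real.exp (t * ‖u‖ ^ 2)) (stdGaussian E) := by
  rw [integrable_stdGaussian_iff]
  simp_rw [smul_eq_mul, stdGaussianDensity_mul_exp]
  exact (integrable_exp_neg_mul_sq_norm (by linarith)).const_mul _

theorem integral_exp_mul_sq_norm_stdGaussian {t : ℝ} (ht : t < 1 / 2) :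
    ∫ u : E, Real.exp (t * ‖u‖ ^ 2) ∂stdGaussian E
      = ((1 - 2 * t)⁻¹) ^ ((Module.finrank ℝ E : ℝ) / 2) := by
  have ht' : 0 < 1 - 2 * t := by linarith
  rw [integral_stdGaussian_eq]
  simp_rw [smul_eq_mul, stdGaussianDensity_mul_exp]
  rw [integral_const_mul, GaussianFourier.integral_rexp_neg_mul_sq_norm (by linarith),
    ← Real.inv_rpow (by positivity), ← Real.mul_rpow (by positivity)
      (div_nonneg Real.pi_pos.le (by linarith))]
  congr 1
  have : (1 : ℝ) / 2 - t ≠ 0 := by linarith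
  field_simp

lemma integrable_norm_pow_mul_exp_stdGaussian (n : ℕ) (c : ℝ) :
    Integrable (fun u : E => ‖u‖ ^ n * Real.exp (c * ‖u‖)) (stdGaussian E) := by
  -- Any rate below `1/2` would do. The power is absorbed by `‖u‖^n ≤ n! e^‖u‖`, and `(c + 1)‖u‖ ≤
  -- (c + 1)² + ‖u‖²/4` by completing the square.
  refine ((integrable_exp_mul_sq_norm_stdGaussian (t := 1 / 4) (by norm_num)).const_mul
    (n.factorial * Real.exp ((c + 1) ^ 2))).mono' (by fun_prop) (ae_of_all _ fun u => ?_)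
  rw [Real.norm_of_nonneg (by positivity)]
  have h1 : ‖u‖ ^ n ≤ n.factorial * Real.exp ‖u‖ := by
    have := Real.pow_div_factorial_le_exp (x := ‖u‖) (norm_nonneg u) n
    rwa [div_le_iff₀ (by positivity), mul_comm] at this
  calc ‖u‖ ^ n * Real.exp (c * ‖u‖)
      ≤ n.factorial * Real.exp ‖u‖ * Real.exp (c * ‖u‖) := by gcongr
    _ = n.factorial * Real.exp (‖u‖ + c * ‖u‖) := by rw [mul_assoc, ← Real.exp_add]
    _ ≤ n.factorial * Real.exp ((c + 1) ^ 2 + 1 / 4 * ‖u‖ ^ 2) := by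
        refine mul_le_mul_of_nonneg_left (Real.exp_le_exp.mpr ?_) (by positivity)
        nlinarith [sq_nonneg ((c + 1) - ‖u‖ / 2)]
    _ = _ := by rw [Real.exp_add, mul_assoc]

lemma integrable_norm_pow_stdGaussian (n : ℕ) :
    Integrable (fun u : E => ‖u‖ ^ n) (stdGaussian E) := by
  simpa using integrable_norm_pow_mul_exp_stdGaussian (E := E) n 0

/-- Maximizing `y ^ q * exp (-t * y)` over `y ≥ 0`. -/
lemma _root_.Real.rpow_le_mul_exp {y q t : ℝ} (hy : 0 ≤ y) (hq : 0 < q) (ht : 0 < t) :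
    y ^ q ≤ (q / t) ^ q * Real.exp (-q) * Real.exp (t * y) := by
  have h : y * t / q ≤ Real.exp (y * t / q - 1) := by
    simpa using Real.add_one_le_exp (y * t / q - 1)
  have h2 : y ≤ q / t * Real.exp (y * t / q - 1) := by
    calc y = q / t * (y * t / q) := by field_simp
      _ ≤ _ := by gcongr
  calc y ^ q ≤ (q / t * Real.exp (y * t / q - 1)) ^ q := by gcongr
    _ = (q / t) ^ q * Real.exp (-q) * Real.exp (t * y) := by
      rw [Real.mul_rpow (by positivity) (by positivity), ← Real.exp_mul, mul_assoc,
        ← Real.exp_add]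
      congr 2
      field_simp
      ring

/-- `E ‖u‖ ^ p ≤ (p + d) ^ (p / 2)` for a standard Gaussian vector `u` in dimension `d`. -/
theorem integral_norm_pow_stdGaussian_le (p : ℕ) :
    ∫ u : E, ‖u‖ ^ p ∂stdGaussian E
      ≤ ((p : ℝ) + Module.finrank ℝ E) ^ ((p : ℝ) / 2) := by
  rcases Nat.eq_zero_or_pos p with rfl | hp
  · simp
  rcases Nat.eq_zero_or_pos (Module.finrank ℝ E) with hd | hd
  · have : Subsingleton E := Module.finrank_zero_iff.mp hd
    have h0 : ∀ u : E, ‖u‖ ^ p = 0 := fun u => by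
      rw [Subsingleton.elim u 0, norm_zero, zero_pow hp.ne']
    simp_rw [h0, integral_zero]
    positivity
  set d : ℝ := ((Module.finrank ℝ E : ℕ) : ℝ) with hd_def
  have hp' : (0 : ℝ) < p := by exact_mod_cast hp
  have hd' : 0 < d := by simpa [hd_def] using hd
  -- This `t` makes the maximum of `y^(p/2) e^(-ty)` equal to `(p + d)^(p/2) e^(-p/2)`. The leftover
  -- factor `e^(-p/2) (1 + p/d)^(d/2)` is at most one because `1 + x ≤ e^x`.
  set t : ℝ := p / (2 * (p + d)) with ht_def
  have ht : 0 < t := by positivity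
  have ht1 : (1 - 2 * t)⁻¹ = 1 + p / d := by
    have : (1 - 2 * t) = d / (p + d) := by rw [ht_def]; field_simp; ring
    rw [this]; field_simp; ring
  have ht2 : t < 1 / 2 := by
    rw [ht_def, div_lt_iff₀ (by positivity)]; linarith
  have hpt : p / 2 / t = p + d := by rw [ht_def]; field_simp
  have hbound : ∀ u : E, ‖u‖ ^ p
      ≤ (p + d) ^ ((p : ℝ) / 2) * Real.exp (-(p / 2)) * Real.exp (t * ‖u‖ ^ 2) := by
    intro u
    have h := Real.rpow_le_mul_exp (y := ‖u‖ ^ 2) (q := (p : ℝ) / 2) (by positivity)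
      (by positivity) ht
    rw [hpt, ← Real.rpow_natCast ‖u‖ 2, ← Real.rpow_mul (norm_nonneg u)] at h
    rw [← Real.rpow_natCast ‖u‖ p]
    convert h using 2
    · push_cast; ring
    · rw [← Real.rpow_natCast]
  calc ∫ u : E, ‖u‖ ^ p ∂stdGaussian E
      ≤ ∫ u : E, (p + d) ^ ((p : ℝ) / 2) * Real.exp (-(p / 2)) * Real.exp (t * ‖u‖ ^ 2)
          ∂stdGaussian E :=
        integral_mono (integrable_norm_pow_stdGaussian p)
          ((integrable_exp_mul_sq_norm_stdGaussian ht2).const_mul _) hbound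
    _ = (p + d) ^ ((p : ℝ) / 2) * (Real.exp (-(p / 2)) * (1 + p / d) ^ (d / 2)) := by
        rw [integral_const_mul, integral_exp_mul_sq_norm_stdGaussian ht2, ht1]; ring
    _ ≤ (p + d) ^ ((p : ℝ) / 2) * (Real.exp (-(p / 2)) * (Real.exp (p / d)) ^ (d / 2)) := by
        gcongr
        linarith [Real.add_one_le_exp (p / d)]
    _ = (p + d) ^ ((p : ℝ) / 2) := by
        rw [← Real.exp_mul, ← Real.exp_add]
        have : -((p : ℝ) / 2) + p / d * (d / 2) = 0 := by field_simp; ring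
        rw [this, Real.exp_zero, mul_one]

lemma integral_inner_sq_stdGaussian (a : E) :
    ∫ u : E, inner ℝ a u ^ 2 ∂stdGaussian E = ‖a‖ ^ 2 := by
  have h := variance_dual_stdGaussian (InnerProductSpace.toDual ℝ E a)
  rw [variance_of_integral_eq_zero (by fun_prop) (integral_strongDual_stdGaussian _)] at h
  simpa using h

theorem integral_norm_sq_stdGaussian :
    ∫ u : E, ‖u‖ ^ 2 ∂stdGaussian E = Module.finrank ℝ E := by
  let b := stdOrthonormalBasis ℝ E
  have h : ∀ u : E, ‖u‖ ^ 2 = ∑ i, inner ℝ (b i) u ^ 2 := fun u => by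
    rw [← b.sum_sq_norm_inner_right u]
    simp
  simp_rw [h]
  rw [integral_finsetSum]
  · simp [integral_inner_sq_stdGaussian]
  · intro i _
    refine (integrable_norm_pow_stdGaussian 2).mono' (by fun_prop) (ae_of_all _ fun u => ?_)
    rw [norm_pow]
    gcongr
    simpa using norm_inner_le_norm (𝕜 := ℝ) (b i) u

/-- Nonnegativity of the variance of `‖u‖`. The general moment bound would only give `√(1 + d)`. -/
theorem integral_norm_stdGaussian_le :
    ∫ u : E, ‖u‖ ∂stdGaussian E ≤ √(Module.finrank ℝ E : ℝ) := by
  set r := √(Module.finrank ℝ E : ℝ)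
  have h := variance_nonneg (fun u : E => ‖u‖) (stdGaussian E)
  have hm : MemLp (fun u : E => ‖u‖) 2 (stdGaussian E) :=
    (IsGaussian.memLp_id (stdGaussian E) 2 (by simp)).norm
  rw [variance_eq_sub hm] at h
  refine Real.le_sqrt_of_sq_le ?_
  have h2 : ∫ u : E, ((fun u : E => ‖u‖) ^ 2) u ∂stdGaussian E = Module.finrank ℝ E :=
    integral_norm_sq_stdGaussian
  linarith

end ProbabilityTheory

/-! ### Subgradients and the growth of `f` -/

/-- A continuous convex function on a Hilbert space has a subgradient at every point. -/
theorem ConvexOn.exists_subgradient {E : Type*} [NormedAddCommGroup E] [InnerProductSpace ℝ E]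
    [CompleteSpace E] {f : E → ℝ} (hf : ConvexOn ℝ Set.univ f) (hc : Continuous f) (x : E) :
    ∃ s : E, ∀ y, f x + inner ℝ s (y - x) ≤ f y := by
  have hconv : Convex ℝ {p : E × ℝ | f p.1 < p.2} := by
    simpa using hf.convex_strict_epigraph
  have hopen : IsOpen {p : E × ℝ | f p.1 < p.2} := isOpen_lt (by fun_prop) (by fun_prop)
  obtain ⟨g, hg⟩ := geometric_hahn_banach_open_point hconv hopen
    (x := (x, f x)) (by simp)
  have hsplit : ∀ y r, g (y, r) = g (y, 0) + r * g (0, 1) := fun y r => by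
    have : ((y, r) : E × ℝ) = (y, 0) + r • (0, 1) := by simp
    rw [this, map_add, map_smul, smul_eq_mul]
  set c : ℝ := g (0, 1) with hc_def
  -- The separating hyperplane is not vertical, since the strict epigraph contains points directly
  -- above `(x, f x)`.
  have hneg : c < 0 := by
    have := hg (x, f x + 1) (by simp)
    rw [hsplit, hsplit x (f x)] at this
    linarith
  -- The graph lies only in the closure of the strict epigraph, so it is approached from above with
  -- slack `ε / (-c)`.
  have hle : ∀ y, g (y, 0) + f y * c ≤ g (x, 0) + f x * c := fun y => by
    refine le_of_forall_pos_lt_add fun ε hε => ?_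
    have := hg (y, f y + ε / (-c)) (by simpa using div_pos hε (neg_pos.mpr hneg))
    rw [hsplit, hsplit x (f x)] at this
    have h2 : (f y + ε / (-c)) * c = f y * c - ε := by
      have := hneg.ne
      field_simp
      ring
    linarith
  let l : StrongDual ℝ E := (-c)⁻¹ • g.comp (ContinuousLinearMap.inl ℝ E ℝ)
  refine ⟨(InnerProductSpace.toDual ℝ E).symm l, fun y => ?_⟩
  rw [InnerProductSpace.toDual_symm_apply]
  have hl : l (y - x) = (-c)⁻¹ * (g (y, 0) - g (x, 0)) := by
    have : ((y - x, 0) : E × ℝ) = (y, 0) - (x, 0) := by simp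
    change (-c)⁻¹ * g (y - x, 0) = _
    rw [this, map_sub]
  rw [hl, ← le_sub_iff_add_le', inv_mul_le_iff₀ (neg_pos.mpr hneg)]
  linarith [hle y]

namespace SPBOpt

variable {d : ℕ} {f : EuclideanSpace ℝ (Fin d) → ℝ}

/-- A subgradient of a locally Lipschitz function is a Clarke subgradient. -/
theorem mem_clarkeSubdiff_of_subgradient (hf : LocallyLipschitz f)
    {x s : EuclideanSpace ℝ (Fin d)} (hs : ∀ y, f x + inner ℝ s (y - x) ≤ f y) :
    s ∈ clarkeSubdiff f x := by
  intro v
  refine le_limsup_of_frequently_le ?_ ?_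
  · have ht : Tendsto (fun t : ℝ => (x, t)) (𝓝[>] 0) (𝓝 x ×ˢ 𝓝[>] 0) :=
      tendsto_const_nhds.prodMk tendsto_id
    refine ht.frequently (Eventually.frequently ?_)
    filter_upwards [self_mem_nhdsWithin] with t ht
    have ht : 0 < t := ht
    have h := hs (x + t • v)
    rw [add_sub_cancel_left, inner_smul_right] at h
    rw [le_div_iff₀ ht]
    linarith
  -- A real `limsup` carries information only for an eventually bounded quotient; the local
  -- Lipschitz constant supplies the bound.
  · obtain ⟨K, U, hU, hK⟩ := hf x
    have h1 : Tendsto (fun p : EuclideanSpace ℝ (Fin d) × ℝ => p.1) (𝓝 x ×ˢ 𝓝[>] 0) (𝓝 x) :=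
      tendsto_fst
    have h2 : Tendsto (fun p : EuclideanSpace ℝ (Fin d) × ℝ => p.1 + p.2 • v)
        (𝓝 x ×ˢ 𝓝[>] 0) (𝓝 x) := by
      have h3 : Tendsto (fun p : EuclideanSpace ℝ (Fin d) × ℝ => p.2) (𝓝 x ×ˢ 𝓝[>] 0) (𝓝 0) :=
        tendsto_snd.mono_right nhdsWithin_le_nhds
      simpa using h1.add (h3.smul_const v)
    have h4 : ∀ᶠ p in 𝓝 x ×ˢ 𝓝[>] (0 : ℝ), 0 < p.2 :=
      tendsto_snd.eventually self_mem_nhdsWithin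
    refine isBoundedUnder_of_eventually_le (a := K * ‖v‖) ?_
    filter_upwards [h1.eventually hU, h2.eventually hU, h4] with p hp1 hp2 hp3
    rw [div_le_iff₀ hp3]
    have h5 := hK.norm_sub_le hp2 hp1
    rw [add_sub_cancel_left, norm_smul, Real.norm_of_nonneg hp3.le] at h5
    calc f (p.1 + p.2 • v) - f p.1 ≤ ‖f (p.1 + p.2 • v) - f p.1‖ := le_abs_self _
      _ ≤ _ := h5
      _ = _ := by ring

variable {R₁ R₂ σ : ℝ} {m : ℕ}

/-- The subgradient inequality at `y` replaces a mean value theorem, so the growth bound is needed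
at that one endpoint only. -/
theorem IsSPB.sub_le (hf : IsSPB f R₁ R₂ m) (hc : ConvexOn ℝ Set.univ f)
    (x y : EuclideanSpace ℝ (Fin d)) :
    f y - f x ≤ (R₁ * ‖y‖ ^ m + R₂) * ‖y - x‖ := by
  obtain ⟨s, hs⟩ := hc.exists_subgradient hf.locallyLipschitz.continuous y
  have hb := hf.bound y s (mem_clarkeSubdiff_of_subgradient hf.locallyLipschitz hs)
  have h1 := hs x
  have h2 : inner ℝ s (y - x) ≤ ‖s‖ * ‖y - x‖ := real_inner_le_norm _ _
  have h3 : inner ℝ s (x - y) = -inner ℝ s (y - x) := by rw [← inner_neg_right, neg_sub]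
  calc f y - f x ≤ ‖s‖ * ‖y - x‖ := by linarith
    _ ≤ _ := by gcongr

/-- The constant `2 ^ (m - 1) * R₁`. -/
noncomputable def growthCoeff (R₁ : ℝ) (m : ℕ) : ℝ := (2 : ℝ) ^ ((m : ℤ) - 1) * R₁

lemma IsSPB.growthCoeff_nonneg (hf : IsSPB f R₁ R₂ m) : 0 ≤ growthCoeff R₁ m :=
  mul_nonneg (by positivity) hf.R₁_nonneg

lemma IsSPB.mul_add_pow_le (hf : IsSPB f R₁ R₂ m) {a b : ℝ} (ha : 0 ≤ a) (hb : 0 ≤ b) :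
    R₁ * (a + b) ^ m ≤ growthCoeff R₁ m * (a ^ m + b ^ m) := by
  -- For `m = 0` the integer exponent `m - 1` is negative, but both sides vanish because `R₁ = 0`.
  rcases Nat.eq_zero_or_pos m with rfl | hm
  · simp [growthCoeff, hf.R₁_eq_zero_iff.mpr rfl]
  · have h1 : (2 : ℝ) ^ ((m : ℤ) - 1) = 2 ^ (m - 1) := by
      rw [← zpow_natCast, Nat.cast_sub hm, Nat.cast_one]
    have h2 := mul_le_mul_of_nonneg_left (add_pow_le ha hb m) hf.R₁_nonneg
    rw [growthCoeff, h1]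
    linarith

/-- Each sign comes from the subgradient at one endpoint, and both endpoints have norm at most `‖x‖
+ σ‖u‖`. -/
theorem IsSPB.abs_add_smul_sub_le (hf : IsSPB f R₁ R₂ m) (hc : ConvexOn ℝ Set.univ f)
    (hσ : 0 < σ) (x u : EuclideanSpace ℝ (Fin d)) :
    |f (x + σ • u) - f x| ≤ σ * ((growthCoeff R₁ m * ‖x‖ ^ m + R₂) * ‖u‖
      + growthCoeff R₁ m * σ ^ m * ‖u‖ ^ (m + 1)) := by
  have hR₁ := hf.R₁_nonneg
  have hn : ‖σ • u‖ = σ * ‖u‖ := by rw [norm_smul, Real.norm_of_nonneg hσ.le]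
  have h1 := hf.sub_le hc x (x + σ • u)
  have h2 := hf.sub_le hc (x + σ • u) x
  rw [add_sub_cancel_left, hn] at h1
  rw [sub_add_cancel_left, norm_neg, hn] at h2
  have hb : ∀ r, 0 ≤ r → r ≤ ‖x‖ + σ * ‖u‖ → (R₁ * r ^ m + R₂) * (σ * ‖u‖)
      ≤ (growthCoeff R₁ m * (‖x‖ ^ m + (σ * ‖u‖) ^ m) + R₂) * (σ * ‖u‖) := by
    intro r hr hr'
    have := hf.mul_add_pow_le (norm_nonneg x) (b := σ * ‖u‖) (by positivity)
    have h3 : R₁ * r ^ m ≤ R₁ * (‖x‖ + σ * ‖u‖) ^ m := by gcongr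
    refine mul_le_mul_of_nonneg_right ?_ (by positivity)
    linarith
  have h3 := hb ‖x + σ • u‖ (norm_nonneg _) ((norm_add_le _ _).trans_eq (by rw [hn]))
  have h4 := hb ‖x‖ (norm_nonneg _) (by linarith [mul_nonneg hσ.le (norm_nonneg u)])
  have h5 : (growthCoeff R₁ m * (‖x‖ ^ m + (σ * ‖u‖) ^ m) + R₂) * (σ * ‖u‖)
      = σ * ((growthCoeff R₁ m * ‖x‖ ^ m + R₂) * ‖u‖
        + growthCoeff R₁ m * σ ^ m * ‖u‖ ^ (m + 1)) := by rw [mul_pow]; ring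
  rw [abs_le]
  constructor <;> linarith

end SPBOpt

/-! ### Integration by parts and the gradient inequality -/

namespace ProbabilityTheory

variable {E : Type*} [NormedAddCommGroup E] [InnerProductSpace ℝ E] [FiniteDimensional ℝ E]
  [MeasurableSpace E] [BorelSpace E] {g : E → ℝ} {C c : ℝ}

lemma integrable_comp_add_stdGaussian (hg : Continuous g) (hc : 0 ≤ c)
    (hb : ∀ u, |g u| ≤ C * Real.exp (c * ‖u‖)) (a : E) :
    Integrable (fun u => g (u + a)) (stdGaussian E) := by
  have hC : 0 ≤ C := by simpa using (abs_nonneg _).trans (hb 0)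
  refine ((integrable_norm_pow_mul_exp_stdGaussian 0 c).const_mul
    (C * Real.exp (c * ‖a‖))).mono' (by fun_prop) (ae_of_all _ fun u => ?_)
  calc ‖g (u + a)‖ ≤ C * Real.exp (c * ‖u + a‖) := hb _
    _ ≤ C * Real.exp (c * ‖a‖ + c * ‖u‖) := by
        refine mul_le_mul_of_nonneg_left (Real.exp_le_exp.mpr ?_) hC
        nlinarith [norm_add_le u a]
    _ = _ := by rw [Real.exp_add]; ring

/-- No derivative of `g` is needed: after Cameron–Martin, `s` appears only in the exponential
weight. For `|s| < 1` its derivative is dominated by a polynomial times an exponential of `‖u‖`,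
which is Gaussian integrable. -/
lemma hasDerivAt_integral_comp_add_stdGaussian (hg : Continuous g)
    (hb : ∀ u, |g u| ≤ C * Real.exp (c * ‖u‖)) (a : E) :
    Integrable (fun u => inner ℝ u a * g u) (stdGaussian E) ∧
    HasDerivAt (fun s : ℝ => ∫ u, g (u + s • a) ∂stdGaussian E)
      (∫ u, inner ℝ u a * g u ∂stdGaussian E) 0 := by
  have hC : 0 ≤ C := by simpa using (abs_nonneg _).trans (hb 0)
  simp_rw [integral_stdGaussian_comp_add g, smul_eq_mul]
  set F : ℝ → E → ℝ := fun s u => Real.exp (inner ℝ u (s • a) - ‖s • a‖ ^ 2 / 2) * g u with hF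
  set F' : ℝ → E → ℝ := fun s u => (inner ℝ u a - s * ‖a‖ ^ 2) * F s u with hF'
  have hexp : ∀ s u, inner ℝ u (s • a) - ‖s • a‖ ^ 2 / 2
      = s * inner ℝ u a - s ^ 2 * ‖a‖ ^ 2 / 2 := fun s u => by
    rw [inner_smul_right, norm_smul, mul_pow, Real.norm_eq_abs, sq_abs]
  have hcont : ∀ s, Continuous (F s) := fun s => by simp only [hF]; fun_prop
  have hcont' : ∀ s, Continuous (F' s) := fun s => by
    have := hcont s
    simp only [hF']; fun_prop
  have hint0 : Integrable (F 0) (stdGaussian E) := by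
    refine ((integrable_norm_pow_mul_exp_stdGaussian 0 c).const_mul C).mono'
      (hcont 0).aestronglyMeasurable (ae_of_all _ fun u => ?_)
    simpa [hF] using hb u
  have hbound : ∀ u, ∀ s ∈ Metric.ball (0 : ℝ) 1, ‖F' s u‖ ≤
      C * ‖a‖ * (‖u‖ ^ 1 * Real.exp ((‖a‖ + c) * ‖u‖))
        + C * ‖a‖ ^ 2 * (‖u‖ ^ 0 * Real.exp ((‖a‖ + c) * ‖u‖)) := by
    intro u s hs
    have hs1 : |s| ≤ 1 := by simpa using (mem_ball_zero_iff.mp hs).le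
    have hin : |inner ℝ u a| ≤ ‖u‖ * ‖a‖ := abs_real_inner_le_norm _ _
    have h1 : |s * inner ℝ u a| ≤ ‖u‖ * ‖a‖ := by
      rw [abs_mul]
      calc |s| * |inner ℝ u a| ≤ 1 * (‖u‖ * ‖a‖) := by gcongr
        _ = _ := one_mul _
    have h2 : |s * ‖a‖ ^ 2| ≤ ‖a‖ ^ 2 := by
      rw [abs_mul, abs_of_nonneg (sq_nonneg ‖a‖)]
      exact mul_le_of_le_one_left (by positivity) hs1
    have h3 : Real.exp (s * inner ℝ u a - s ^ 2 * ‖a‖ ^ 2 / 2) ≤ Real.exp (‖a‖ * ‖u‖) := by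
      refine Real.exp_le_exp.mpr ?_
      nlinarith [le_abs_self (s * inner ℝ u a), mul_nonneg (sq_nonneg s) (sq_nonneg ‖a‖)]
    have h4 : |inner ℝ u a - s * ‖a‖ ^ 2| ≤ ‖u‖ * ‖a‖ + ‖a‖ ^ 2 :=
      (abs_sub _ _).trans (add_le_add hin h2)
    have h5 : |g u| ≤ C * Real.exp (c * ‖u‖) := hb u
    simp only [hF', hF, hexp, norm_mul, Real.norm_eq_abs, Real.abs_exp]
    calc _ ≤ (‖u‖ * ‖a‖ + ‖a‖ ^ 2) * (Real.exp (‖a‖ * ‖u‖) * (C * Real.exp (c * ‖u‖))) := by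
          gcongr
      _ = _ := by rw [add_mul ‖a‖ c, Real.exp_add]; ring
  have hderiv : ∀ u, ∀ s ∈ Metric.ball (0 : ℝ) 1, HasDerivAt (fun s => F s u) (F' s u) s := by
    intro u s _
    have h1 : HasDerivAt (fun s : ℝ => s * inner ℝ u a - s ^ 2 * ‖a‖ ^ 2 / 2)
        (inner ℝ u a - s * ‖a‖ ^ 2) s := by
      have := ((hasDerivAt_id s).mul_const (inner ℝ u a)).sub
        ((((hasDerivAt_id s).pow 2).mul_const (‖a‖ ^ 2)).div_const 2)
      refine this.congr_deriv ?_
      simp only [id_eq]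
      push_cast
      ring
    have h2 := (h1.exp.mul_const (g u))
    simp only [hF', hF, hexp]
    refine h2.congr_deriv ?_
    ring
  have hfin := hasDerivAt_integral_of_dominated_loc_of_deriv_le (μ := stdGaussian E)
    (Metric.ball_mem_nhds (0 : ℝ) one_pos)
    (Eventually.of_forall fun s => (hcont s).aestronglyMeasurable) hint0
    (hcont' 0).aestronglyMeasurable (ae_of_all _ hbound)
    (((integrable_norm_pow_mul_exp_stdGaussian 1 _).const_mul _).add
      ((integrable_norm_pow_mul_exp_stdGaussian 0 _).const_mul _)) (ae_of_all _ hderiv)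
  simpa [hF', hF] using hfin

/-- The gradient inequality for the Gaussian smoothing of a convex function `g`, where the
gradient is expressed through Gaussian integration by parts. -/
theorem integral_inner_mul_le_of_convexOn (hg : Continuous g) (hconv : ConvexOn ℝ Set.univ g)
    (hc : 0 ≤ c) (hb : ∀ u, |g u| ≤ C * Real.exp (c * ‖u‖)) (a : E) :
    ∫ u, inner ℝ u a * g u ∂stdGaussian E
      ≤ ∫ u, g (u + a) ∂stdGaussian E - ∫ u, g u ∂stdGaussian E := by
  have hint := integrable_comp_add_stdGaussian hg hc hb
  have hφ : ConvexOn ℝ Set.univ (fun s : ℝ => ∫ u, g (u + s • a) ∂stdGaussian E) := by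
    refine ⟨convex_univ, fun s _ t _ p q hp hq hpq => ?_⟩
    simp only [smul_eq_mul]
    rw [← integral_const_mul, ← integral_const_mul,
      ← integral_add ((hint _).const_mul _) ((hint _).const_mul _)]
    refine integral_mono (hint _) (((hint _).const_mul _).add ((hint _).const_mul _)) fun u => ?_
    have h := hconv.2 (Set.mem_univ (u + s • a)) (Set.mem_univ (u + t • a)) hp hq hpq
    have he : u + (p * s + q * t) • a = p • (u + s • a) + q • (u + t • a) := by
      calc u + (p * s + q * t) • a = (p + q) • u + (p * s + q * t) • a := by rw [hpq, one_smul]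
        _ = _ := by module
    simp only [he]
    simpa using h
  -- On the segment from `0` to `a` the smoothing is convex in `s`, so its derivative at `0` is at
  -- most its slope over `[0, 1]`.
  have h := hφ.le_slope_of_hasDerivAt (Set.mem_univ 0) (Set.mem_univ 1) one_pos
    (hasDerivAt_integral_comp_add_stdGaussian hg hb a).2
  simpa [slope_def_field] using h

end ProbabilityTheory

/-! ### Smoothing error and moments of the estimator -/

namespace SPBOpt

variable {d : ℕ} {f : EuclideanSpace ℝ (Fin d) → ℝ} {R₁ R₂ σ : ℝ} {m : ℕ}

theorem IsSPB.abs_add_smul_le_exp (hf : IsSPB f R₁ R₂ m) (hc : ConvexOn ℝ Set.univ f)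
    (hσ : 0 < σ) (x u : EuclideanSpace ℝ (Fin d)) :
    |f (x + σ • u)| ≤ (|f x| + σ * ((growthCoeff R₁ m * ‖x‖ ^ m + R₂)
      + growthCoeff R₁ m * σ ^ m * (m + 1).factorial)) * Real.exp (1 * ‖u‖) := by
  have hA := hf.growthCoeff_nonneg
  have hR₂ := hf.R₂_pos.le
  rw [one_mul]
  have h1 : ‖u‖ ≤ Real.exp ‖u‖ := by linarith [Real.add_one_le_exp ‖u‖]
  have h2 : ‖u‖ ^ (m + 1) ≤ (m + 1).factorial * Real.exp ‖u‖ := by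
    have := Real.pow_div_factorial_le_exp (x := ‖u‖) (norm_nonneg u) (m + 1)
    rwa [div_le_iff₀ (by positivity), mul_comm] at this
  have h3 : |f x| ≤ |f x| * Real.exp ‖u‖ :=
    le_mul_of_one_le_right (abs_nonneg _) (Real.one_le_exp (norm_nonneg u))
  calc |f (x + σ • u)| ≤ |f x| + |f (x + σ • u) - f x| := by
        linarith [abs_sub_abs_le_abs_sub (f (x + σ • u)) (f x)]
    _ ≤ |f x| * Real.exp ‖u‖ + σ * ((growthCoeff R₁ m * ‖x‖ ^ m + R₂) * Real.exp ‖u‖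
        + growthCoeff R₁ m * σ ^ m * ((m + 1).factorial * Real.exp ‖u‖)) := by
        refine add_le_add h3 ((hf.abs_add_smul_sub_le hc hσ x u).trans ?_)
        gcongr
    _ = _ := by ring

lemma convexOn_comp_add_smul (hc : ConvexOn ℝ Set.univ f) (x : EuclideanSpace ℝ (Fin d)) (σ : ℝ) :
    ConvexOn ℝ Set.univ (fun u => f (x + σ • u)) := by
  refine ⟨convex_univ, fun u _ v _ p q hp hq hpq => ?_⟩
  have he : x + σ • (p • u + q • v) = p • (x + σ • u) + q • (x + σ • v) := by
    calc x + σ • (p • u + q • v) = (p + q) • x + σ • (p • u + q • v) := by rw [hpq, one_smul]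
      _ = _ := by module
  simp only [he]
  exact hc.2 trivial trivial hp hq hpq

theorem IsSPB.integrable_add_smul (hf : IsSPB f R₁ R₂ m) (hc : ConvexOn ℝ Set.univ f)
    (hσ : 0 < σ) (x : EuclideanSpace ℝ (Fin d)) :
    Integrable (fun u => f (x + σ • u)) (stdGaussian (EuclideanSpace ℝ (Fin d))) := by
  have hcont := hf.locallyLipschitz.continuous
  simpa using integrable_comp_add_stdGaussian (g := fun u => f (x + σ • u)) (by fun_prop)
    zero_le_one (hf.abs_add_smul_le_exp hc hσ x) 0

lemma integral_inner_stdGaussian (s : EuclideanSpace ℝ (Fin d)) :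
    ∫ u, inner ℝ s u ∂stdGaussian (EuclideanSpace ℝ (Fin d)) = 0 := by
  simpa using integral_strongDual_stdGaussian (InnerProductSpace.toDual ℝ _ s)

lemma integrable_inner_stdGaussian (s : EuclideanSpace ℝ (Fin d)) :
    Integrable (fun u => inner ℝ s u) (stdGaussian (EuclideanSpace ℝ (Fin d))) :=
  IsGaussian.integrable_id.const_inner s

/-- Jensen's inequality: in the integrated subgradient inequality at `x` the linear term has mean
zero. -/
theorem IsSPB.le_gaussianSmoothing (hf : IsSPB f R₁ R₂ m) (hc : ConvexOn ℝ Set.univ f)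
    (hσ : 0 < σ) (x : EuclideanSpace ℝ (Fin d)) : f x ≤ gaussianSmoothing f σ x := by
  obtain ⟨s, hs⟩ := hc.exists_subgradient hf.locallyLipschitz.continuous x
  have hi := (integrable_inner_stdGaussian s).const_mul σ
  have h : ∫ u, (f x + σ * inner ℝ s u) ∂stdGaussian (EuclideanSpace ℝ (Fin d))
      ≤ gaussianSmoothing f σ x := by
    refine integral_mono ((integrable_const _).add hi) (hf.integrable_add_smul hc hσ x)
      fun u => ?_
    simpa [inner_smul_right] using hs (x + σ • u)
  rw [integral_add (integrable_const _) hi, integral_const_mul, integral_inner_stdGaussian] at h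
  simpa using h

theorem IsSPB.gaussianSmoothing_sub_le (hf : IsSPB f R₁ R₂ m) (hc : ConvexOn ℝ Set.univ f)
    (hσ : 0 < σ) (x : EuclideanSpace ℝ (Fin d)) :
    gaussianSmoothing f σ x - f x ≤ Mconst d m R₁ R₂ σ x * σ := by
  have hA := hf.growthCoeff_nonneg
  have hR₂ := hf.R₂_pos.le
  have hi1 : Integrable (fun u => (growthCoeff R₁ m * ‖x‖ ^ m + R₂) * ‖u‖)
      (stdGaussian (EuclideanSpace ℝ (Fin d))) := IsGaussian.integrable_id.norm.const_mul _
  have hi2 := (integrable_norm_pow_stdGaussian (E := EuclideanSpace ℝ (Fin d)) (m + 1)).const_mul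
    (growthCoeff R₁ m * σ ^ m)
  have hi3 := hf.integrable_add_smul hc hσ x
  have h1 : gaussianSmoothing f σ x - f x
      = ∫ u, (f (x + σ • u) - f x) ∂stdGaussian (EuclideanSpace ℝ (Fin d)) := by
    rw [integral_sub hi3 (integrable_const _)]
    simp [gaussianSmoothing]
  have h2 := integral_norm_stdGaussian_le (E := EuclideanSpace ℝ (Fin d))
  have h3 := integral_norm_pow_stdGaussian_le (E := EuclideanSpace ℝ (Fin d)) (m + 1)
  rw [finrank_euclideanSpace_fin] at h2 h3
  push_cast at h3
  calc gaussianSmoothing f σ x - f x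
      ≤ ∫ u, σ * ((growthCoeff R₁ m * ‖x‖ ^ m + R₂) * ‖u‖
          + growthCoeff R₁ m * σ ^ m * ‖u‖ ^ (m + 1))
          ∂stdGaussian (EuclideanSpace ℝ (Fin d)) := by
        rw [h1]
        exact integral_mono (hi3.sub (integrable_const _)) ((hi1.add hi2).const_mul σ)
          fun u => (le_abs_self _).trans (hf.abs_add_smul_sub_le hc hσ x u)
    _ = ((growthCoeff R₁ m * ‖x‖ ^ m + R₂) * ∫ u, ‖u‖ ∂stdGaussian (EuclideanSpace ℝ (Fin d))
          + growthCoeff R₁ m * σ ^ m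
            * ∫ u, ‖u‖ ^ (m + 1) ∂stdGaussian (EuclideanSpace ℝ (Fin d))) * σ := by
        rw [integral_const_mul, integral_add hi1 hi2, integral_const_mul, integral_const_mul,
          mul_comm]
    _ ≤ ((growthCoeff R₁ m * ‖x‖ ^ m + R₂) * √(d : ℝ) + growthCoeff R₁ m * σ ^ m
          * ((m : ℝ) + 1 + (d : ℝ)) ^ (((m : ℝ) + 1) / 2)) * σ := by gcongr
    _ = _ := rfl

theorem IsSPB.Mconst_nonneg (hf : IsSPB f R₁ R₂ m) (hσ : 0 < σ) (x : EuclideanSpace ℝ (Fin d)) :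
    0 ≤ Mconst d m R₁ R₂ σ x := by
  have hR₁ := hf.R₁_nonneg
  have hR₂ := hf.R₂_pos.le
  unfold Mconst
  positivity

theorem IsSPB.norm_estimator_le (hf : IsSPB f R₁ R₂ m) (hc : ConvexOn ℝ Set.univ f)
    (hσ : 0 < σ) (x u : EuclideanSpace ℝ (Fin d)) :
    ‖estimator f σ x u‖ ≤ (growthCoeff R₁ m * ‖x‖ ^ m + R₂) * ‖u‖ ^ 2
      + growthCoeff R₁ m * σ ^ m * ‖u‖ ^ (m + 2) := by
  rw [estimator, norm_smul, norm_mul, Real.norm_of_nonneg (by positivity), Real.norm_eq_abs,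
    one_div]
  calc σ⁻¹ * |f (x + σ • u) - f x| * ‖u‖
      ≤ σ⁻¹ * (σ * ((growthCoeff R₁ m * ‖x‖ ^ m + R₂) * ‖u‖
        + growthCoeff R₁ m * σ ^ m * ‖u‖ ^ (m + 1))) * ‖u‖ := by
        gcongr
        exact hf.abs_add_smul_sub_le hc hσ x u
    _ = _ := by rw [inv_mul_cancel_left₀ hσ.ne']; ring

lemma continuous_estimator (hf : Continuous f) :
    Continuous (fun p : EuclideanSpace ℝ (Fin d) × EuclideanSpace ℝ (Fin d) =>
      estimator f σ p.1 p.2) := by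
  unfold estimator
  fun_prop

/-- The factor 3 in `Hconst` for `p = 2` arises here, from `(p + q + r)² ≤ 3(p² + q² + r²)`. -/
lemma IsSPB.norm_estimator_sq_le (hf : IsSPB f R₁ R₂ m) (hc : ConvexOn ℝ Set.univ f)
    (hσ : 0 < σ) (x u : EuclideanSpace ℝ (Fin d)) :
    ‖estimator f σ x u‖ ^ 2
      ≤ 3 * (growthCoeff R₁ m ^ 2 * (‖x‖ ^ m) ^ 2 + R₂ ^ 2) * ‖u‖ ^ 4
        + 3 * (growthCoeff R₁ m * σ ^ m) ^ 2 * ‖u‖ ^ (2 * m + 4) := by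
  have h := hf.norm_estimator_le hc hσ x u
  set p := growthCoeff R₁ m * ‖x‖ ^ m * ‖u‖ ^ 2 with hp
  set q := R₂ * ‖u‖ ^ 2 with hq
  set r := growthCoeff R₁ m * σ ^ m * ‖u‖ ^ (m + 2) with hr
  calc ‖estimator f σ x u‖ ^ 2 ≤ (p + q + r) ^ 2 := by
        gcongr
        linarith
    _ ≤ 3 * (p ^ 2 + q ^ 2 + r ^ 2) := by
        nlinarith [sq_nonneg (p - q), sq_nonneg (q - r), sq_nonneg (p - r)]
    _ = _ := by rw [hp, hq, hr]; ring

theorem IsSPB.integrable_norm_estimator_sq (hf : IsSPB f R₁ R₂ m) (hc : ConvexOn ℝ Set.univ f)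
    (hσ : 0 < σ) (x : EuclideanSpace ℝ (Fin d)) :
    Integrable (fun u => ‖estimator f σ x u‖ ^ 2) (stdGaussian (EuclideanSpace ℝ (Fin d))) := by
  have hcont := (continuous_estimator (σ := σ) hf.locallyLipschitz.continuous).comp
    (Continuous.prodMk_right x)
  refine Integrable.mono' (g := fun u =>
      3 * (growthCoeff R₁ m ^ 2 * (‖x‖ ^ m) ^ 2 + R₂ ^ 2) * ‖u‖ ^ 4
        + 3 * (growthCoeff R₁ m * σ ^ m) ^ 2 * ‖u‖ ^ (2 * m + 4))
    (((integrable_norm_pow_stdGaussian 4).const_mul _).add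
      ((integrable_norm_pow_stdGaussian (2 * m + 4)).const_mul _))
    (hcont.norm.pow 2).aestronglyMeasurable (ae_of_all _ fun u => ?_)
  rw [Real.norm_of_nonneg (by positivity)]
  exact hf.norm_estimator_sq_le hc hσ x u

/-- The growth in `x` is exactly the squared normalization of the step. The maximum in `Hconst`
dominates both the coefficient of `‖x‖^(2m)` and the constant term, and `X² + 1 ≤ (X + 1)²` for `X =
‖x‖^m`. -/
theorem IsSPB.integral_norm_estimator_sq_le (hf : IsSPB f R₁ R₂ m)
    (hc : ConvexOn ℝ Set.univ f) (hσ : 0 < σ) (x : EuclideanSpace ℝ (Fin d)) :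
    ∫ u, ‖estimator f σ x u‖ ^ 2 ∂stdGaussian (EuclideanSpace ℝ (Fin d))
      ≤ Hconst d m R₁ R₂ σ 2 * (‖x‖ ^ m + 1) ^ 2 := by
  have hi1 := (integrable_norm_pow_stdGaussian (E := EuclideanSpace ℝ (Fin d)) 4).const_mul
    (3 * (growthCoeff R₁ m ^ 2 * (‖x‖ ^ m) ^ 2 + R₂ ^ 2))
  have hi2 := (integrable_norm_pow_stdGaussian (E := EuclideanSpace ℝ (Fin d))
    (2 * m + 4)).const_mul (3 * (growthCoeff R₁ m * σ ^ m) ^ 2)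
  have h1 := integral_norm_pow_stdGaussian_le (E := EuclideanSpace ℝ (Fin d)) 4
  have h2 := integral_norm_pow_stdGaussian_le (E := EuclideanSpace ℝ (Fin d)) (2 * m + 4)
  rw [finrank_euclideanSpace_fin] at h1 h2
  have e1 : (((4 : ℕ) : ℝ) + d) ^ (((4 : ℕ) : ℝ) / 2) = (2 * ((2 : ℕ) : ℝ) + d) ^ 2 := by
    rw [← Real.rpow_natCast]
    norm_num
  have e2 : (((2 * m + 4 : ℕ) : ℝ) + d) ^ (((2 * m + 4 : ℕ) : ℝ) / 2)
      = (((m : ℝ) + 2) * ((2 : ℕ) : ℝ) + d) ^ (((m : ℝ) + 2) * ((2 : ℕ) : ℝ) / 2) := by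
    push_cast
    congr 1 <;> ring
  rw [e1] at h1
  rw [e2] at h2
  set D := (2 * ((2 : ℕ) : ℝ) + (d : ℝ)) ^ 2 with hD
  set D' := (((m : ℝ) + 2) * ((2 : ℕ) : ℝ) + d) ^ (((m : ℝ) + 2) * ((2 : ℕ) : ℝ) / 2) with hD'
  set A := growthCoeff R₁ m with hA
  have hA2 : (2 : ℝ) ^ (((m : ℤ) - 1) * ((2 : ℕ) : ℤ)) * R₁ ^ 2 = A ^ 2 := by
    rw [hA, growthCoeff, mul_pow, zpow_mul, zpow_natCast]
  have hH : Hconst d m R₁ R₂ σ 2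
      = 3 * max (A ^ 2 * D) (R₂ ^ 2 * D + A ^ 2 * σ ^ (m * 2) * D') := by
    rw [Hconst, if_neg two_ne_zero, hA2]
    change (3 : ℝ) ^ 1 * _ = _
    rw [pow_one]
  set M := max (A ^ 2 * D) (R₂ ^ 2 * D + A ^ 2 * σ ^ (m * 2) * D') with hM
  have hM1 : A ^ 2 * D ≤ M := le_max_left _ _
  have hM2 : R₂ ^ 2 * D + A ^ 2 * σ ^ (m * 2) * D' ≤ M := le_max_right _ _
  have hM0 : 0 ≤ M := le_trans (by positivity) hM1
  have hX : 0 ≤ ‖x‖ ^ m := by positivity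
  calc ∫ u, ‖estimator f σ x u‖ ^ 2 ∂stdGaussian (EuclideanSpace ℝ (Fin d))
      ≤ ∫ u, (3 * (A ^ 2 * (‖x‖ ^ m) ^ 2 + R₂ ^ 2) * ‖u‖ ^ 4
        + 3 * (A * σ ^ m) ^ 2 * ‖u‖ ^ (2 * m + 4)) ∂stdGaussian (EuclideanSpace ℝ (Fin d)) :=
        integral_mono (hf.integrable_norm_estimator_sq hc hσ x) (hi1.add hi2)
          (hf.norm_estimator_sq_le hc hσ x)
    _ ≤ 3 * (A ^ 2 * (‖x‖ ^ m) ^ 2 + R₂ ^ 2) * D + 3 * (A * σ ^ m) ^ 2 * D' := by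
        rw [integral_add hi1 hi2, integral_const_mul, integral_const_mul]
        gcongr
    _ = 3 * (A ^ 2 * D * (‖x‖ ^ m) ^ 2 + (R₂ ^ 2 * D + A ^ 2 * σ ^ (m * 2) * D')) := by
        rw [mul_pow, ← pow_mul]; ring
    _ ≤ 3 * (M * (‖x‖ ^ m) ^ 2 + M) := by gcongr
    _ ≤ 3 * M * (‖x‖ ^ m + 1) ^ 2 := by nlinarith [mul_nonneg hM0 hX]
    _ = _ := by rw [hH]

theorem IsSPB.integrable_estimator (hf : IsSPB f R₁ R₂ m) (hc : ConvexOn ℝ Set.univ f)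
    (hσ : 0 < σ) (x : EuclideanSpace ℝ (Fin d)) :
    Integrable (fun u => estimator f σ x u) (stdGaussian (EuclideanSpace ℝ (Fin d))) := by
  have hcont := (continuous_estimator (σ := σ) hf.locallyLipschitz.continuous).comp
    (Continuous.prodMk_right x)
  exact (((integrable_norm_pow_stdGaussian 2).const_mul _).add
    ((integrable_norm_pow_stdGaussian (m + 2)).const_mul _)).mono'
    hcont.aestronglyMeasurable (ae_of_all _ fun u => hf.norm_estimator_le hc hσ x u)

/-- The estimator is, in expectation, a subgradient of the Gaussian smoothing. -/
theorem IsSPB.gaussianSmoothing_sub_le_integral_inner_estimator (hf : IsSPB f R₁ R₂ m)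
    (hc : ConvexOn ℝ Set.univ f) (hσ : 0 < σ) (x z : EuclideanSpace ℝ (Fin d)) :
    gaussianSmoothing f σ x - gaussianSmoothing f σ z
      ≤ ∫ u, inner ℝ (estimator f σ x u) (x - z) ∂stdGaussian (EuclideanSpace ℝ (Fin d)) := by
  have hcont := hf.locallyLipschitz.continuous
  -- Chosen so that shifting `u` by `a` moves `x + σ u` to `z + σ u`. The baseline `f x` in the
  -- estimator then contributes a term linear in `u`, of mean zero.
  set a := σ⁻¹ • (z - x) with ha
  have hg : Continuous (fun u => f (x + σ • u)) := by fun_prop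
  have h := integral_inner_mul_le_of_convexOn hg (convexOn_comp_add_smul hc x σ)
    zero_le_one (hf.abs_add_smul_le_exp hc hσ x) a
  have hi := (hasDerivAt_integral_comp_add_stdGaussian hg (hf.abs_add_smul_le_exp hc hσ x) a).1
  have e1 : ∀ u, x + σ • (u + a) = z + σ • u := fun u => by
    rw [ha, smul_add, smul_inv_smul₀ hσ.ne']; abel
  simp_rw [e1] at h
  have e2 : ∀ u, inner ℝ (estimator f σ x u) (x - z)
      = f x * inner ℝ a u - inner ℝ u a * f (x + σ • u) := fun u => by
    rw [estimator, real_inner_smul_left, ha, real_inner_smul_left, real_inner_smul_right,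
      real_inner_comm u, ← neg_sub z x, inner_neg_right]
    ring
  simp_rw [e2]
  rw [integral_sub ((integrable_inner_stdGaussian a).const_mul _) hi, integral_const_mul,
    integral_inner_stdGaussian]
  simp only [gaussianSmoothing]
  linarith

/-! ### Projection and the one-step inequality -/

theorem norm_proj_sub_proj_le {Ω : Set (EuclideanSpace ℝ (Fin d))} (hne : Ω.Nonempty)
    (hcl : IsClosed Ω) (hcv : Convex ℝ Ω) (x y : EuclideanSpace ℝ (Fin d)) :
    ‖proj Ω x - proj Ω y‖ ≤ ‖x - y‖ := by
  obtain ⟨hx, hx'⟩ := (isNearest_iff_inner hcv _ _).mp (isNearest_proj hne hcl x)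
  obtain ⟨hy, hy'⟩ := (isNearest_iff_inner hcv _ _).mp (isNearest_proj hne hcl y)
  have h1 := hx' _ hy
  have h2 := hy' _ hx
  -- The last two terms are nonpositive by the variational inequalities, leaving `‖p - q‖² ≤ ⟨x - y,
  -- p - q⟩` for the two projections.
  have e : inner ℝ (proj Ω x - proj Ω y) (proj Ω x - proj Ω y)
      = inner ℝ (x - y) (proj Ω x - proj Ω y) + inner ℝ (x - proj Ω x) (proj Ω y - proj Ω x)
        + inner ℝ (y - proj Ω y) (proj Ω x - proj Ω y) := by
    simp only [inner_sub_left, inner_sub_right]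
    ring
  have h3 := real_inner_le_norm (x - y) (proj Ω x - proj Ω y)
  rw [real_inner_self_eq_norm_sq] at e
  by_contra! hlt
  nlinarith [norm_nonneg (x - y)]

theorem continuous_proj {Ω : Set (EuclideanSpace ℝ (Fin d))} (hne : Ω.Nonempty)
    (hcl : IsClosed Ω) (hcv : Convex ℝ Ω) : Continuous (proj Ω) :=
  (LipschitzWith.of_dist_le_mul (K := 1) fun x y => by
    simpa [dist_eq_norm] using norm_proj_sub_proj_le hne hcl hcv x y).continuous

theorem proj_eq_self {Ω : Set (EuclideanSpace ℝ (Fin d))} (hcl : IsClosed Ω)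
    (hcv : Convex ℝ Ω) {z : EuclideanSpace ℝ (Fin d)} (hz : z ∈ Ω) : proj Ω z = z :=
  ((isNearest_iff_eq_proj ⟨z, hz⟩ hcl hcv z z).mp ⟨hz, fun y _ => by simp⟩).symm

theorem norm_proj_sub_le {Ω : Set (EuclideanSpace ℝ (Fin d))} (hcl : IsClosed Ω)
    (hcv : Convex ℝ Ω) {z : EuclideanSpace ℝ (Fin d)} (hz : z ∈ Ω)
    (x : EuclideanSpace ℝ (Fin d)) : ‖proj Ω x - z‖ ≤ ‖x - z‖ := by
  simpa [proj_eq_self hcl hcv hz] using norm_proj_sub_proj_le ⟨z, hz⟩ hcl hcv x z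

/-- One step of the projected zeroth-order method from `x` in the direction `u`. -/
noncomputable def step (f : EuclideanSpace ℝ (Fin d) → ℝ) (Ω : Set (EuclideanSpace ℝ (Fin d)))
    (m : ℕ) (σ t : ℝ) (x u : EuclideanSpace ℝ (Fin d)) : EuclideanSpace ℝ (Fin d) :=
  proj Ω (x - (t / (‖x‖ ^ m + 1)) • estimator f σ x u)

variable {Ω : Set (EuclideanSpace ℝ (Fin d))} {t : ℝ}

lemma continuous_step (hf : Continuous f) (hne : Ω.Nonempty) (hcl : IsClosed Ω)
    (hcv : Convex ℝ Ω) :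
    Continuous (fun p : EuclideanSpace ℝ (Fin d) × EuclideanSpace ℝ (Fin d) =>
      step f Ω m σ t p.1 p.2) := by
  have h1 := continuous_proj hne hcl hcv
  have h2 := continuous_estimator (σ := σ) hf
  have h3 : ∀ p : EuclideanSpace ℝ (Fin d) × EuclideanSpace ℝ (Fin d), ‖p.1‖ ^ m + 1 ≠ 0 :=
    fun p => by positivity
  unfold step
  fun_prop (disch := exact h3)

theorem IsSPB.integral_norm_step_sub_sq_le (hf : IsSPB f R₁ R₂ m)
    (hc : ConvexOn ℝ Set.univ f) (hσ : 0 < σ) (hcl : IsClosed Ω) (hcv : Convex ℝ Ω)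
    {z : EuclideanSpace ℝ (Fin d)} (hz : z ∈ Ω) (x : EuclideanSpace ℝ (Fin d)) :
    ∫ u, ‖step f Ω m σ t x u - z‖ ^ 2 ∂stdGaussian (EuclideanSpace ℝ (Fin d))
      ≤ ‖x - z‖ ^ 2 - 2 * (t / (‖x‖ ^ m + 1))
          * ∫ u, inner ℝ (estimator f σ x u) (x - z) ∂stdGaussian (EuclideanSpace ℝ (Fin d))
        + Hconst d m R₁ R₂ σ 2 * t ^ 2 := by
  set c := t / (‖x‖ ^ m + 1) with hc_def
  have hX : 0 < ‖x‖ ^ m + 1 := by positivity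
  have hi1 := (hf.integrable_estimator hc hσ x).inner_const (𝕜 := ℝ) (x - z)
  have hi2 := hf.integrable_norm_estimator_sq hc hσ x
  have hpt : ∀ u, ‖step f Ω m σ t x u - z‖ ^ 2
      ≤ ‖x - z‖ ^ 2 - 2 * c * inner ℝ (estimator f σ x u) (x - z)
        + c ^ 2 * ‖estimator f σ x u‖ ^ 2 := fun u => by
    have h := norm_proj_sub_le hcl hcv hz (x - c • estimator f σ x u)
    calc ‖step f Ω m σ t x u - z‖ ^ 2 ≤ ‖(x - z) - c • estimator f σ x u‖ ^ 2 := by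
          rw [sub_right_comm]
          exact pow_le_pow_left₀ (norm_nonneg _) h 2
      _ = _ := by
          rw [norm_sub_sq_real, real_inner_smul_right, norm_smul, mul_pow, Real.norm_eq_abs,
            sq_abs, real_inner_comm]
          ring
  have hi3 : Integrable (fun u => ‖x - z‖ ^ 2 - 2 * c * inner ℝ (estimator f σ x u) (x - z))
      (stdGaussian (EuclideanSpace ℝ (Fin d))) := (integrable_const _).sub (hi1.const_mul _)
  have hi : Integrable (fun u => ‖x - z‖ ^ 2 - 2 * c * inner ℝ (estimator f σ x u) (x - z)
        + c ^ 2 * ‖estimator f σ x u‖ ^ 2) (stdGaussian (EuclideanSpace ℝ (Fin d))) :=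
    hi3.add (hi2.const_mul _)
  have h1 := integral_mono_of_nonneg (μ := stdGaussian (EuclideanSpace ℝ (Fin d)))
    (ae_of_all _ fun u => by positivity) hi (ae_of_all _ hpt)
  rw [integral_add hi3 (hi2.const_mul _),
    integral_sub (integrable_const _) (hi1.const_mul _), integral_const_mul,
    integral_const_mul] at h1
  have h2 : c ^ 2 * ∫ u, ‖estimator f σ x u‖ ^ 2 ∂stdGaussian (EuclideanSpace ℝ (Fin d))
      ≤ Hconst d m R₁ R₂ σ 2 * t ^ 2 := by
    calc _ ≤ c ^ 2 * (Hconst d m R₁ R₂ σ 2 * (‖x‖ ^ m + 1) ^ 2) := by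
          gcongr
          exact hf.integral_norm_estimator_sq_le hc hσ x
      _ = _ := by rw [hc_def]; field_simp
  simp only [integral_const, probReal_univ, one_smul] at h1
  linarith

theorem IsSPB.integral_norm_step_sub_sq_le_smoothing (hf : IsSPB f R₁ R₂ m)
    (hc : ConvexOn ℝ Set.univ f) (hσ : 0 < σ) (hcl : IsClosed Ω) (hcv : Convex ℝ Ω)
    {z : EuclideanSpace ℝ (Fin d)} (hz : z ∈ Ω) (ht : 0 ≤ t) (x : EuclideanSpace ℝ (Fin d)) :
    ∫ u, ‖step f Ω m σ t x u - z‖ ^ 2 ∂stdGaussian (EuclideanSpace ℝ (Fin d))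
      ≤ ‖x - z‖ ^ 2 - 2 * (t / (‖x‖ ^ m + 1))
          * (gaussianSmoothing f σ x - gaussianSmoothing f σ z)
        + Hconst d m R₁ R₂ σ 2 * t ^ 2 := by
  refine (hf.integral_norm_step_sub_sq_le hc hσ hcl hcv hz x).trans ?_
  have := hf.gaussianSmoothing_sub_le_integral_inner_estimator hc hσ x z
  gcongr

/-- Replacing `f_σ` by `f` is free at `x`, where `f ≤ f_σ`, so the smoothing error is paid only at
the fixed point `z`. Division by `‖x‖^m + 1 ≥ 1` can only shrink it. -/
theorem IsSPB.integral_norm_step_sub_sq_le_gap (hf : IsSPB f R₁ R₂ m)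
    (hc : ConvexOn ℝ Set.univ f) (hσ : 0 < σ) (hcl : IsClosed Ω) (hcv : Convex ℝ Ω)
    {z : EuclideanSpace ℝ (Fin d)} (hz : z ∈ Ω) (ht : 0 ≤ t) (x : EuclideanSpace ℝ (Fin d)) :
    ∫ u, ‖step f Ω m σ t x u - z‖ ^ 2 ∂stdGaussian (EuclideanSpace ℝ (Fin d))
      ≤ ‖x - z‖ ^ 2 - 2 * t * ((f x - f z) / (‖x‖ ^ m + 1))
        + 2 * t * (Mconst d m R₁ R₂ σ z * σ) + Hconst d m R₁ R₂ σ 2 * t ^ 2 := by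
  have h1 := hf.integral_norm_step_sub_sq_le_smoothing hc hσ hcl hcv hz ht x
  have h2 := hf.le_gaussianSmoothing hc hσ x
  have h3 := hf.gaussianSmoothing_sub_le hc hσ z
  have hM := mul_nonneg (hf.Mconst_nonneg hσ z) hσ.le
  have hX : 1 ≤ ‖x‖ ^ m + 1 := by linarith [pow_nonneg (norm_nonneg x) m]
  have h4 : (f x - f z - Mconst d m R₁ R₂ σ z * σ) / (‖x‖ ^ m + 1)
      ≤ (gaussianSmoothing f σ x - gaussianSmoothing f σ z) / (‖x‖ ^ m + 1) :=
    div_le_div_of_nonneg_right (by linarith) (by linarith)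
  have h5 : Mconst d m R₁ R₂ σ z * σ / (‖x‖ ^ m + 1) ≤ Mconst d m R₁ R₂ σ z * σ :=
    div_le_self hM hX
  have h6 : (f x - f z) / (‖x‖ ^ m + 1) - Mconst d m R₁ R₂ σ z * σ
      ≤ (gaussianSmoothing f σ x - gaussianSmoothing f σ z) / (‖x‖ ^ m + 1) := by
    rw [sub_div] at h4
    linarith
  have h7 := mul_le_mul_of_nonneg_left h6 (by positivity : 0 ≤ 2 * t)
  have h8 : 2 * (t / (‖x‖ ^ m + 1)) * (gaussianSmoothing f σ x - gaussianSmoothing f σ z)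
      = 2 * t * ((gaussianSmoothing f σ x - gaussianSmoothing f σ z) / (‖x‖ ^ m + 1)) := by ring
  linarith

end SPBOpt

/-! ### Iterates: independence, integrability and conditioning -/

namespace SPBOpt

variable {d : ℕ} {f : EuclideanSpace ℝ (Fin d) → ℝ} {R₁ R₂ σ : ℝ} {m : ℕ}
  {Ω : Set (EuclideanSpace ℝ (Fin d))} {τ : ℕ → ℝ} {x0 : EuclideanSpace ℝ (Fin d)}

lemma iterate_succ (u : ℕ → EuclideanSpace ℝ (Fin d)) (k : ℕ) :
    iterate f Ω m σ τ x0 u (k + 1) = step f Ω m σ (τ k) (iterate f Ω m σ τ x0 u k) (u k) := rfl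

lemma iterate_congr {u v : ℕ → EuclideanSpace ℝ (Fin d)} {k : ℕ} (h : ∀ j < k, u j = v j) :
    iterate f Ω m σ τ x0 u k = iterate f Ω m σ τ x0 v k := by
  induction k with
  | zero => rfl
  | succ k ih =>
    rw [iterate_succ, iterate_succ, ih fun j hj => h j (hj.trans k.lt_succ_self),
      h k k.lt_succ_self]

lemma iterate_mem (hcl : IsClosed Ω) (hx0 : x0 ∈ Ω) (u : ℕ → EuclideanSpace ℝ (Fin d)) (k : ℕ) :
    iterate f Ω m σ τ x0 u k ∈ Ω := by
  cases k with
  | zero => exact hx0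
  | succ k => exact (isNearest_proj ⟨x0, hx0⟩ hcl _).1

lemma continuous_iterate (hf : Continuous f) (hne : Ω.Nonempty) (hcl : IsClosed Ω)
    (hcv : Convex ℝ Ω) (k : ℕ) :
    Continuous (fun u : ℕ → EuclideanSpace ℝ (Fin d) => iterate f Ω m σ τ x0 u k) := by
  induction k with
  | zero => exact continuous_const
  | succ k ih =>
    have h := continuous_step (m := m) (σ := σ) (t := τ k) hf hne hcl hcv
    simp only [iterate_succ]
    have h' : Continuous (fun u : ℕ → EuclideanSpace ℝ (Fin d) => u k) := continuous_apply k
    have h'' := h.comp (ih.prodMk h')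
    simpa only [Function.comp_def] using h''

variable {S : Type*} [MeasurableSpace S] {P : Measure S}
  {u : ℕ → S → EuclideanSpace ℝ (Fin d)}

lemma measurable_iterate (hf : Continuous f) (hne : Ω.Nonempty) (hcl : IsClosed Ω)
    (hcv : Convex ℝ Ω) (hum : ∀ k, Measurable (u k)) (k : ℕ) :
    Measurable (fun s => iterate f Ω m σ τ x0 (fun j => u j s) k) :=
  (continuous_iterate hf hne hcl hcv k).measurable.comp (measurable_pi_lambda _ hum)

/-- The `k`-th iterate is independent of the `k`-th direction. -/
lemma indepFun_iterate (hf : Continuous f) (hne : Ω.Nonempty) (hcl : IsClosed Ω)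
    (hcv : Convex ℝ Ω) (hum : ∀ k, Measurable (u k)) (huind : iIndepFun u P) (k : ℕ) :
    IndepFun (fun s => iterate f Ω m σ τ x0 (fun j => u j s) k) (u k) P := by
  -- Padding a finite tuple by zeros does not change the `k`-th iterate, which is thus a measurable
  -- function of the directions before `k`.
  let ext (w : Finset.range k → EuclideanSpace ℝ (Fin d)) (j : ℕ) : EuclideanSpace ℝ (Fin d) :=
    if h : j ∈ Finset.range k then w ⟨j, h⟩ else 0
  have hext : Measurable ext := by
    refine measurable_pi_lambda _ fun j => ?_
    by_cases h : j ∈ Finset.range k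
    · simpa only [ext, h, dif_pos] using measurable_pi_apply _
    · simpa only [ext, h, dif_neg, not_false_eq_true] using measurable_const
  have h := (huind.indepFun_finset (Finset.range k) {k} (by simp) hum).comp
    ((continuous_iterate (m := m) (σ := σ) (τ := τ) (x0 := x0) hf hne hcl hcv k).measurable.comp
      hext)
    (measurable_pi_apply (⟨k, Finset.mem_singleton_self k⟩ : ({k} : Finset ℕ)))
  refine h.congr (ae_of_all _ fun s => ?_) (ae_of_all _ fun s => rfl)
  refine iterate_congr fun j hj => ?_
  simp [ext, hj]

/-- The normalization cancels `‖x‖^m`, so the increment depends on `u` alone. Square integrability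
therefore propagates by induction without higher moments of the iterate. -/
lemma IsSPB.norm_step_sub_le (hf : IsSPB f R₁ R₂ m) (hc : ConvexOn ℝ Set.univ f) (hσ : 0 < σ)
    (hcl : IsClosed Ω) (hcv : Convex ℝ Ω) {z : EuclideanSpace ℝ (Fin d)} (hz : z ∈ Ω) {t : ℝ}
    (ht : 0 ≤ t) (ht1 : t ≤ 1) (x u : EuclideanSpace ℝ (Fin d)) :
    ‖step f Ω m σ t x u - z‖ ≤ ‖x - z‖ + ((growthCoeff R₁ m + R₂) * ‖u‖ ^ 2
      + growthCoeff R₁ m * σ ^ m * ‖u‖ ^ (m + 2)) := by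
  have hA := hf.growthCoeff_nonneg
  have hR₂ := hf.R₂_pos.le
  have hX : 0 ≤ ‖x‖ ^ m := by positivity
  set c := t / (‖x‖ ^ m + 1) with hc_def
  have hc0 : 0 ≤ c := by positivity
  have hcX : c * (‖x‖ ^ m + 1) = t := by rw [hc_def]; field_simp
  have hc1 : c ≤ 1 := by nlinarith
  have hcX1 : c * ‖x‖ ^ m ≤ 1 := by linarith
  have h1 := hf.norm_estimator_le hc hσ x u
  calc ‖step f Ω m σ t x u - z‖ ≤ ‖x - c • estimator f σ x u - z‖ :=
        norm_proj_sub_le hcl hcv hz _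
    _ ≤ ‖x - z‖ + ‖c • estimator f σ x u‖ := by
        rw [sub_right_comm]; exact norm_sub_le _ _
    _ ≤ ‖x - z‖ + c * ((growthCoeff R₁ m * ‖x‖ ^ m + R₂) * ‖u‖ ^ 2
          + growthCoeff R₁ m * σ ^ m * ‖u‖ ^ (m + 2)) := by
        rw [norm_smul, Real.norm_of_nonneg hc0]
        gcongr
    _ = ‖x - z‖ + ((growthCoeff R₁ m * (c * ‖x‖ ^ m) + c * R₂) * ‖u‖ ^ 2
          + c * (growthCoeff R₁ m * σ ^ m * ‖u‖ ^ (m + 2))) := by ring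
    _ ≤ ‖x - z‖ + ((growthCoeff R₁ m * 1 + 1 * R₂) * ‖u‖ ^ 2
          + 1 * (growthCoeff R₁ m * σ ^ m * ‖u‖ ^ (m + 2))) := by gcongr
    _ = _ := by ring

lemma memLp_norm_pow_stdGaussian (n : ℕ) :
    MemLp (fun u => ‖u‖ ^ n) 2 (stdGaussian (EuclideanSpace ℝ (Fin d))) := by
  rw [memLp_two_iff_integrable_sq (by fun_prop)]
  simp_rw [← pow_mul]
  exact integrable_norm_pow_stdGaussian _

variable [IsProbabilityMeasure P]

theorem IsSPB.memLp_iterate (hf : IsSPB f R₁ R₂ m) (hc : ConvexOn ℝ Set.univ f) (hσ : 0 < σ)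
    (hcl : IsClosed Ω) (hcv : Convex ℝ Ω) (hx0 : x0 ∈ Ω) (hτ : ∀ k, 0 < τ k ∧ τ k ≤ 1)
    (hum : ∀ k, Measurable (u k))
    (hulaw : ∀ k, P.map (u k) = stdGaussian (EuclideanSpace ℝ (Fin d)))
    (k : ℕ) (z : EuclideanSpace ℝ (Fin d)) :
    MemLp (fun s => iterate f Ω m σ τ x0 (fun j => u j s) k - z) 2 P := by
  have hne : Ω.Nonempty := ⟨x0, hx0⟩
  have hmeas := measurable_iterate (m := m) (σ := σ) (τ := τ) (x0 := x0)
    hf.locallyLipschitz.continuous hne hcl hcv hum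
  have hpow : ∀ k n, MemLp (fun s => ‖u k s‖ ^ n) 2 P := fun k n => by
    have h := memLp_norm_pow_stdGaussian (d := d) n
    rw [← hulaw k] at h
    exact (memLp_map_measure_iff h.1 (hum k).aemeasurable).mp h
  -- The step estimate needs a reference point in `Ω`; induction runs with `x0`, and an arbitrary
  -- `z` differs by a constant.
  suffices h : MemLp (fun s => iterate f Ω m σ τ x0 (fun j => u j s) k - x0) 2 P by
    have h' := h.add (memLp_const (x0 - z))
    refine h'.ae_eq (ae_of_all _ fun s => ?_)
    simp
  induction k with
  | zero => exact memLp_const (x0 - x0)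
  | succ k ih =>
    refine MemLp.of_le (ih.norm.add (((hpow k 2).const_mul (growthCoeff R₁ m + R₂)).add
      ((hpow k (m + 2)).const_mul (growthCoeff R₁ m * σ ^ m))))
      ((hmeas (k + 1)).sub_const x0).aestronglyMeasurable (ae_of_all _ fun s => ?_)
    exact (hf.norm_step_sub_le hc hσ hcl hcv hx0 (hτ k).1.le (hτ k).2 _ _).trans (le_abs_self _)

/-- Conditioning on the current iterate: a bound on the Gaussian expectation after one step that
is valid on `Ω` may be integrated along the iteration. -/
theorem IsSPB.integral_norm_iterate_succ_sub_sq_le (hf : IsSPB f R₁ R₂ m)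
    (hc : ConvexOn ℝ Set.univ f) (hσ : 0 < σ) (hcl : IsClosed Ω) (hcv : Convex ℝ Ω)
    (hx0 : x0 ∈ Ω) (hτ : ∀ k, 0 < τ k ∧ τ k ≤ 1) (hum : ∀ k, Measurable (u k))
    (hulaw : ∀ k, P.map (u k) = stdGaussian (EuclideanSpace ℝ (Fin d)))
    (huind : iIndepFun u P) (k : ℕ) (z : EuclideanSpace ℝ (Fin d))
    {φ : EuclideanSpace ℝ (Fin d) → ℝ} (hφ : Continuous φ)
    (hφi : Integrable (fun s => φ (iterate f Ω m σ τ x0 (fun j => u j s) k)) P)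
    (hle : ∀ y ∈ Ω, ∫ v, ‖step f Ω m σ (τ k) y v - z‖ ^ 2
      ∂stdGaussian (EuclideanSpace ℝ (Fin d)) ≤ φ y) :
    ∫ s, ‖iterate f Ω m σ τ x0 (fun j => u j s) (k + 1) - z‖ ^ 2 ∂P
      ≤ ∫ s, φ (iterate f Ω m σ τ x0 (fun j => u j s) k) ∂P := by
  have hfc := hf.locallyLipschitz.continuous
  have hne : Ω.Nonempty := ⟨x0, hx0⟩
  have hX := measurable_iterate (m := m) (σ := σ) (τ := τ) (x0 := x0) hfc hne hcl hcv hum k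
  have hind := indepFun_iterate (m := m) (σ := σ) (τ := τ) (x0 := x0) hfc hne hcl hcv hum huind k
  -- The joint law is a product, so Fubini takes the place of conditional expectation.
  have hmap := hind.map_prod_eq_prod_map_map hX.aemeasurable (hum k).aemeasurable
  rw [hulaw k] at hmap
  set X := fun s => iterate f Ω m σ τ x0 (fun j => u j s) k with hX_def
  have hpair : AEMeasurable (fun s => (X s, u k s)) P := (hX.prodMk (hum k)).aemeasurable
  set ψ : EuclideanSpace ℝ (Fin d) × EuclideanSpace ℝ (Fin d) → ℝ :=
    fun p => ‖step f Ω m σ (τ k) p.1 p.2 - z‖ ^ 2 with hψ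
  have hψc : Continuous ψ :=
    (((continuous_step hfc hne hcl hcv).sub continuous_const).norm).pow 2
  have hψi : Integrable ψ ((P.map X).prod (stdGaussian (EuclideanSpace ℝ (Fin d)))) := by
    rw [← hmap, integrable_map_measure hψc.aestronglyMeasurable hpair]
    exact (hf.memLp_iterate hc hσ hcl hcv hx0 hτ hum hulaw (k + 1) z).integrable_norm_pow
      two_ne_zero
  have hΩ : ∀ᵐ y ∂P.map X, y ∈ Ω :=
    (ae_map_iff hX.aemeasurable hcl.measurableSet).mpr
      (ae_of_all _ fun s => iterate_mem hcl hx0 _ k)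
  calc ∫ s, ‖iterate f Ω m σ τ x0 (fun j => u j s) (k + 1) - z‖ ^ 2 ∂P
      = ∫ p, ψ p ∂P.map (fun s => (X s, u k s)) :=
        (integral_map hpair hψc.aestronglyMeasurable).symm
    _ = ∫ y, ∫ v, ψ (y, v) ∂stdGaussian (EuclideanSpace ℝ (Fin d)) ∂P.map X := by
        rw [hmap, integral_prod _ hψi]
    _ ≤ ∫ y, φ y ∂P.map X := by
        refine integral_mono_ae hψi.integral_prod_left
          ((integrable_map_measure hφ.aestronglyMeasurable hX.aemeasurable).mpr hφi) ?_
        filter_upwards [hΩ] with y hy using hle y hy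
    _ = _ := integral_map hX.aemeasurable hφ.aestronglyMeasurable

/-- After normalization the gap grows only linearly in `‖x - z‖`, so it is integrable along the
iterates. -/
lemma IsSPB.abs_gap_div_le (hf : IsSPB f R₁ R₂ m) (hc : ConvexOn ℝ Set.univ f)
    (x z : EuclideanSpace ℝ (Fin d)) :
    |(f x - f z) / (‖x‖ ^ m + 1)| ≤ (R₁ + R₁ * ‖z‖ ^ m + R₂) * ‖x - z‖ := by
  have hR₁ := hf.R₁_nonneg
  have hR₂ := hf.R₂_pos.le
  have hX : 0 ≤ ‖x‖ ^ m := by positivity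
  have hZ : 0 ≤ R₁ * ‖z‖ ^ m := by positivity
  have h1 := hf.sub_le hc z x
  have h2 := hf.sub_le hc x z
  rw [norm_sub_rev z x] at h2
  have hx : R₁ * ‖x‖ ^ m + R₂ ≤ (R₁ + R₁ * ‖z‖ ^ m + R₂) * (‖x‖ ^ m + 1) := by
    nlinarith [mul_nonneg hZ hX, mul_nonneg hR₂ hX]
  have hz : R₁ * ‖z‖ ^ m + R₂ ≤ (R₁ + R₁ * ‖z‖ ^ m + R₂) * (‖x‖ ^ m + 1) := by
    nlinarith [mul_nonneg hZ hX, mul_nonneg hR₂ hX, mul_nonneg hR₁ hX]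
  have hx' := mul_le_mul_of_nonneg_right hx (norm_nonneg (x - z))
  have hz' := mul_le_mul_of_nonneg_right hz (norm_nonneg (x - z))
  rw [abs_div, abs_of_pos (by positivity : 0 < ‖x‖ ^ m + 1), div_le_iff₀ (by positivity), abs_le]
  constructor <;> nlinarith

end SPBOpt

/-! ### Telescoping and the main theorem -/

/-- Averaging a perturbed descent recursion `a (k + 1) ≤ a k - 2 τ g + 2 τ M + H τ²`. -/
lemma Finset.inf'_le_of_descent {a g τ : ℕ → ℝ} {M H : ℝ} (hτ : ∀ k, 0 < τ k)
    (ha : ∀ k, 0 ≤ a k)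
    (hrec : ∀ k, a (k + 1) ≤ a k - 2 * τ k * g k + 2 * τ k * M + H * τ k ^ 2) (T : ℕ) :
    (Finset.range (T + 1)).inf' Finset.nonempty_range_add_one g
      ≤ 1 / (2 * ∑ k ∈ Finset.range (T + 1), τ k)
          * (a 0 + H * ∑ k ∈ Finset.range (T + 1), τ k ^ 2) + M := by
  set I := (Finset.range (T + 1)).inf' Finset.nonempty_range_add_one g
  -- Replacing each `g k` by the minimum `I` makes the recursion telescope; the final `a (T + 1) ≥
  -- 0` is dropped.
  have hsum : ∀ n ≤ T + 1, a n + 2 * I * ∑ k ∈ Finset.range n, τ k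
      ≤ a 0 + 2 * M * ∑ k ∈ Finset.range n, τ k + H * ∑ k ∈ Finset.range n, τ k ^ 2 := by
    intro n
    induction n with
    | zero => simp
    | succ n ih =>
      intro hn
      have h1 := ih (by omega)
      have h2 : I ≤ g n := Finset.inf'_le _ (Finset.mem_range.mpr hn)
      have h3 := mul_le_mul_of_nonneg_left h2 (hτ n).le
      rw [Finset.sum_range_succ, Finset.sum_range_succ]
      linarith [hrec n]
  have hpos : 0 < ∑ k ∈ Finset.range (T + 1), τ k :=
    Finset.sum_pos (fun k _ => hτ k) Finset.nonempty_range_add_one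
  have h := hsum (T + 1) le_rfl
  rw [← sub_le_iff_le_add, one_div_mul_eq_div, le_div_iff₀ (by positivity)]
  linarith [ha (T + 1)]

theorem theorem4p5 {d : ℕ} (f : EuclideanSpace ℝ (Fin d) → ℝ) (R₁ R₂ : ℝ) (m : ℕ)
    (hspb : SPBOpt.IsSPB f R₁ R₂ m) (hconv : ConvexOn ℝ Set.univ f)
    (Ω : Set (EuclideanSpace ℝ (Fin d))) (hΩc : IsClosed Ω) (hΩv : Convex ℝ Ω)
    (xs : EuclideanSpace ℝ (Fin d)) (hxs : xs ∈ Ω) (hmin : IsMinOn f Ω xs)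
    (x0 : EuclideanSpace ℝ (Fin d)) (hx0 : x0 ∈ Ω)
    (τ : ℕ → ℝ) (hτ : ∀ k, 0 < τ k ∧ τ k ≤ 1) (σ : ℝ) (hσ : 0 < σ)
    {S : Type*} [MeasurableSpace S] (P : Measure S) [IsProbabilityMeasure P]
    (u : ℕ → S → EuclideanSpace ℝ (Fin d)) (hum : ∀ k, Measurable (u k))
    (hulaw : ∀ k, P.map (u k) = stdGaussian (EuclideanSpace ℝ (Fin d)))
    (huind : iIndepFun u P)
    (x : ℕ → S → EuclideanSpace ℝ (Fin d))
    (hx : ∀ k s, x k s = SPBOpt.iterate f Ω m σ τ x0 (fun j => u j s) k) :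
    (∀ k z, Integrable (fun s => ‖x k s - z‖ ^ 2) P) ∧
    (∀ k, Integrable (fun s => (f (x k s) - f xs) / (‖x k s‖ ^ m + 1)) P) ∧
    (∀ k, ∀ z ∈ Ω, IsMinOn (SPBOpt.gaussianSmoothing f σ) Ω z →
      0 ≤ (∫ s, ‖x k s - z‖ ^ 2 ∂P) - (∫ s, ‖x (k + 1) s - z‖ ^ 2 ∂P)
        + SPBOpt.Hconst d m R₁ R₂ σ 2 * τ k ^ 2) ∧
    (∀ T : ℕ, 0 < T →
      (Finset.range (T + 1)).inf' Finset.nonempty_range_add_one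
          (fun k => ∫ s, (f (x k s) - f xs) / (‖x k s‖ ^ m + 1) ∂P)
        ≤ 1 / (2 * ∑ k ∈ Finset.range (T + 1), τ k)
            * (‖x0 - xs‖ ^ 2
              + SPBOpt.Hconst d m R₁ R₂ σ 2 * ∑ k ∈ Finset.range (T + 1), τ k ^ 2)
          + SPBOpt.Mconst d m R₁ R₂ σ xs * σ) := by
  have hfc := hspb.locallyLipschitz.continuous
  have hne : Ω.Nonempty := ⟨x0, hx0⟩
  have hL := fun k z => hspb.memLp_iterate hconv hσ hΩc hΩv hx0 hτ hum hulaw k z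
  have hsq : ∀ k z, Integrable (fun s => ‖x k s - z‖ ^ 2) P := fun k z => by
    simp_rw [hx]
    exact (hL k z).integrable_norm_pow two_ne_zero
  have hφc : Continuous (fun y => (f y - f xs) / (‖y‖ ^ m + 1)) :=
    (hfc.sub continuous_const).div (by fun_prop) fun y => by positivity
  have hgap : ∀ k, Integrable (fun s => (f (x k s) - f xs) / (‖x k s‖ ^ m + 1)) P := fun k => by
    simp_rw [hx]
    refine ((((hL k xs).integrable one_le_two).norm).const_mul
      (R₁ + R₁ * ‖xs‖ ^ m + R₂)).mono' ?_ (ae_of_all _ fun s => hspb.abs_gap_div_le hconv _ xs)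
    exact (hφc.measurable.comp
      (SPBOpt.measurable_iterate hfc hne hΩc hΩv hum k)).aestronglyMeasurable
  refine ⟨hsq, hgap, fun k z hz hzmin => ?_, fun T _ => ?_⟩
  · have hi : Integrable
        (fun s => ‖x k s - z‖ ^ 2 + SPBOpt.Hconst d m R₁ R₂ σ 2 * τ k ^ 2) P :=
      (hsq k z).add (integrable_const (SPBOpt.Hconst d m R₁ R₂ σ 2 * τ k ^ 2))
    have h := hspb.integral_norm_iterate_succ_sub_sq_le hconv hσ hΩc hΩv hx0 hτ hum hulaw huind k z
      (φ := fun y => ‖y - z‖ ^ 2 + SPBOpt.Hconst d m R₁ R₂ σ 2 * τ k ^ 2) (by fun_prop)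
      (by simpa only [hx] using hi) fun y hy => by
        have h1 := hspb.integral_norm_step_sub_sq_le_smoothing hconv hσ hΩc hΩv hz (hτ k).1.le y
        have h2 : SPBOpt.gaussianSmoothing f σ z ≤ SPBOpt.gaussianSmoothing f σ y := hzmin hy
        -- As `z` minimizes `f_σ` itself, the descent term has a sign and no smoothing error enters.
        have h3 : 0 ≤ 2 * (τ k / (‖y‖ ^ m + 1))
            * (SPBOpt.gaussianSmoothing f σ y - SPBOpt.gaussianSmoothing f σ z) :=
          mul_nonneg (mul_nonneg zero_le_two (div_nonneg (hτ k).1.le (by positivity)))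
            (sub_nonneg.mpr h2)
        linarith
    simp_rw [← hx] at h
    rw [integral_add (hsq k z) (integrable_const _)] at h
    simp only [integral_const, probReal_univ, one_smul] at h
    linarith
  · have hrec := Finset.inf'_le_of_descent (a := fun k => ∫ s, ‖x k s - xs‖ ^ 2 ∂P)
      (g := fun k => ∫ s, (f (x k s) - f xs) / (‖x k s‖ ^ m + 1) ∂P) (τ := τ)
      (M := SPBOpt.Mconst d m R₁ R₂ σ xs * σ) (H := SPBOpt.Hconst d m R₁ R₂ σ 2)
      (fun k => (hτ k).1) (fun k => integral_nonneg fun s => by positivity) (fun k => ?_) T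
    · have h0 : ∫ s, ‖x 0 s - xs‖ ^ 2 ∂P = ‖x0 - xs‖ ^ 2 := by
        simp [hx, SPBOpt.iterate]
      simpa only [h0] using hrec
    · have hi1 := (hgap k).const_mul (2 * τ k)
      have hi2 : Integrable (fun s => ‖x k s - xs‖ ^ 2
          - 2 * τ k * ((f (x k s) - f xs) / (‖x k s‖ ^ m + 1))) P := (hsq k xs).sub hi1
      have hi3 := integrable_const (μ := P) (2 * τ k * (SPBOpt.Mconst d m R₁ R₂ σ xs * σ))
      have hi4 : Integrable (fun s => ‖x k s - xs‖ ^ 2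
          - 2 * τ k * ((f (x k s) - f xs) / (‖x k s‖ ^ m + 1))
          + 2 * τ k * (SPBOpt.Mconst d m R₁ R₂ σ xs * σ)) P := hi2.add hi3
      have hi5 := integrable_const (μ := P) (SPBOpt.Hconst d m R₁ R₂ σ 2 * τ k ^ 2)
      have hi6 : Integrable (fun s => ‖x k s - xs‖ ^ 2
          - 2 * τ k * ((f (x k s) - f xs) / (‖x k s‖ ^ m + 1))
          + 2 * τ k * (SPBOpt.Mconst d m R₁ R₂ σ xs * σ)
          + SPBOpt.Hconst d m R₁ R₂ σ 2 * τ k ^ 2) P := hi4.add hi5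
      have h := hspb.integral_norm_iterate_succ_sub_sq_le hconv hσ hΩc hΩv hx0 hτ hum hulaw huind
        k xs (φ := fun y => ‖y - xs‖ ^ 2 - 2 * τ k * ((f y - f xs) / (‖y‖ ^ m + 1))
          + 2 * τ k * (SPBOpt.Mconst d m R₁ R₂ σ xs * σ) + SPBOpt.Hconst d m R₁ R₂ σ 2 * τ k ^ 2)
        (by fun_prop) (by simpa only [hx] using hi6) fun y _ =>
          hspb.integral_norm_step_sub_sq_le_gap hconv hσ hΩc hΩv hxs (hτ k).1.le y
      simp_rw [← hx] at h
      rw [integral_add hi4 hi5, integral_add hi2 hi3, integral_sub (hsq k xs) hi1,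
        integral_const_mul] at h
      simpa only [integral_const, probReal_univ, one_smul] using h
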